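/- Let $n\ge 0$ and let $x_1,\dots,x_{2n}$ be variables, the symmetric group $\mathfrak S_{2n}$ acting by permuting them, with $s_i$ ($1\le i<2n$) exchanging $x_i$ and $x_{i+1}$. Let $\mathcal H_{2n}=\mathbb Z[x_1,\dots,x_{2n}]/\mathfrak{Sym}_+$, where $\mathfrak{Sym}_+$ is the ideal generated by the symmetric polynomials without constant term. On $\mathcal H_{2n}$ let $(\cdot,\cdot)^\partial$ be the (well-defined) $\mathbb Z$-bilinear form such that $(x^u,x^v)^\partial=(-1)^{\ell(\sigma)}$ if some permutation $\sigma$ rearranges $u+v$ into $[2n-1,\dots,1,0]$, and $(x^u,x^v)^\partial=0$ if there is no such permutation. Let $\rho=[n-1,\dots,1,0]$ and consider partitions $\lambda\le\rho$, that is, whose diagram is contained in that of $\rho$. Label each box of the diagram of $\lambda$ by a pair $[i,k]$: the number $i$ is $n$ in the first box, increases by $1$ at each step to the right and decreases by $1$ at each step downwards; the number $k$ is $0$ for the corners of $\lambda$, $1$ for the corners of the diagram obtained by erasing these corners, and so on. (a) Let $KL^x_\lambda\in\mathbb Q[x_1,\dots,x_{2n}]$ be obtained from $KL^x_0=x_1\cdots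 x_n$ by reading the boxes of $\lambda$ by successive rows (first row first, each row from left to right), and by applying successively, for each box $[i,k]$, the operator $f\mapsto f s_i+\frac1{1+k}f$. (b) Let $LK^x_\mu\in\mathcal H_{2n}$, $\mu\le\rho$, be the family generated from $LK^x_\rho=x_1^0x_2^0x_3^2x_4^2\cdots x_{2n-1}^{2n-2}x_{2n}^{2n-2}$ by the rule $LK^x_\nu=-(LK^x_\mu s_i+LK^x_\mu)$ whenever $\nu$ is obtained from $\mu$ by erasing a corner with first label $i$ (the result does not depend on the order in which the boxes are erased). Then for every $\lambda\le\rho$ the polynomial $KL^x_\lambda$ has integer coefficients, hence defines a class in $\mathcal H_{2n}$, and for all $\lambda,\mu\le\rho$ $$\bigl(KL^x_\lambda,\,LK^x_\mu\bigr)^\partial=\delta_{\lambda,\mu}.$$ -/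

import Mathlib

namespace KLDual

open MvPolynomial

instance instDecEqYoungDiagram : DecidableEq YoungDiagram :=
  fun a b => decidable_of_iff (a.cells = b.cells) YoungDiagram.ext_iff.symm

/-! ### Partitions inside the staircase and their bi-labelled diagrams -/

/-- The staircase partition `ρ = [n-1, …, 1, 0]`, as a Young diagram (row `i`, column `j`, both
counted from `0`). The relation `μ ≤ ρ` is inclusion of diagrams. -/
def staircase (n : ℕ) : YoungDiagram where
  cells := (Finset.range n ×ˢ Finset.range n).filter fun c => c.1 + c.2 + 1 < n
  isLowerSet := by
    rintro ⟨i, j⟩ ⟨i', j'⟩ ⟨h1, h2⟩ h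
    simp only [Finset.coe_filter, Finset.mem_product, Finset.mem_range, Set.mem_ofPred_eq] at h h1 h2 ⊢
    omega

/-- A corner of a diagram: a box with no box of the diagram to its right or below it. -/
def IsCorner (μ : YoungDiagram) (c : ℕ × ℕ) : Prop :=
  c ∈ μ ∧ (c.1 + 1, c.2) ∉ μ ∧ (c.1, c.2 + 1) ∉ μ

/-- The diagram obtained by erasing all the corners. -/
def eraseCorners (μ : YoungDiagram) : YoungDiagram where
  cells := μ.cells.filter fun c => (c.1 + 1, c.2) ∈ μ ∨ (c.1, c.2 + 1) ∈ μ
  isLowerSet := by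
    rintro ⟨i, j⟩ ⟨i', j'⟩ ⟨h1, h2⟩ h
    simp only [Finset.coe_filter, YoungDiagram.mem_cells, Set.mem_ofPred_eq] at h h1 h2 ⊢
    refine ⟨μ.up_left_mem h1 h2 h.1, h.2.imp (fun h' => ?_) (fun h' => ?_)⟩
    · exact μ.up_left_mem (by omega) h2 h'
    · exact μ.up_left_mem h1 (by omega) h'

/-- First label of a box: it equals `n` in the first box, increases by one when moving rightwards
and decreases by one when moving downwards. -/
def content (n : ℕ) (c : ℕ × ℕ) : ℕ := n + c.2 - c.1

/-- Second label of a box: `0` for the corners of `μ`, `1` for the corners of the diagram left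
after erasing the corners, and so on. -/
noncomputable def depth (μ : YoungDiagram) (c : ℕ × ℕ) : ℕ :=
  sInf {k | c ∉ eraseCorners^[k + 1] μ}

/-- The boxes of a diagram, read by successive rows, each row from left to right. -/
def rowReading (μ : YoungDiagram) : List (ℕ × ℕ) :=
  (List.range (μ.colLen 0)).flatMap fun i => (List.range (μ.rowLen i)).map fun j => (i, j)

/-! ### The action of the symmetric group -/

/-- The simple transposition `s_m`, `1 ≤ m < N`, exchanging the variables `x_m` and `x_{m+1}`;
the variable `x_m` has index `m - 1` in `Fin N`. -/
def simpleSwap (N m : ℕ) : Equiv.Perm (Fin N) :=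
  if h : 1 ≤ m ∧ m < N then Equiv.swap ⟨m - 1, by omega⟩ ⟨m, h.2⟩ else 1

/-! ### The polynomials `KL^x` -/

/-- The monomial `x_1 ⋯ x_n` in the `2n` variables. -/
noncomputable def KLx0 (n : ℕ) : MvPolynomial (Fin (2 * n)) ℚ :=
  ∏ i : Fin (2 * n), if (i : ℕ) < n then X i else 1

/-- The image of `x_1 ⋯ x_n` under the bi-labelled diagram of `μ`, read by successive rows, an
entry `[i, k]` sending `f` to `f s_i + (1 + k)⁻¹ f`. -/
noncomputable def KLx (n : ℕ) (μ : YoungDiagram) : MvPolynomial (Fin (2 * n)) ℚ :=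
  (rowReading μ).foldl
    (fun f c => rename (simpleSwap (2 * n) (content n c)) f + C ((1 + (depth μ c : ℚ))⁻¹) * f)
    (KLx0 n)

/-! ### The coinvariant ring -/

/-- The ideal generated by the symmetric polynomials without constant term. -/
noncomputable def symPlus (N : ℕ) : Ideal (MvPolynomial (Fin N) ℤ) :=
  Ideal.span {p | p.IsSymmetric ∧ constantCoeff p = 0}

/-- The ring `ℤ[x_1, …, x_N] / Sym_+`. -/
abbrev Coinv (N : ℕ) : Type := MvPolynomial (Fin N) ℤ ⧸ symPlus N

/-- The action of the symmetric group on the coinvariant ring by permutation of the variables. -/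
noncomputable def act {N : ℕ} (e : Equiv.Perm (Fin N)) : Coinv N →+* Coinv N :=
  Ideal.quotientMap (symPlus N) (rename e : MvPolynomial (Fin N) ℤ →ₐ[ℤ] _).toRingHom (by
    rw [symPlus, Ideal.span_le]
    rintro p ⟨hp, h0⟩
    refine Ideal.subset_span ⟨?_, ?_⟩
    · simpa [hp e] using hp
    · simpa [hp e] using h0)

theorem act_mk {N : ℕ} (e : Equiv.Perm (Fin N)) (p : MvPolynomial (Fin N) ℤ) :
    act e (Ideal.Quotient.mk _ p) = Ideal.Quotient.mk _ (rename e p) := rfl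

/-! ### The form `( , )^∂` -/

/-- The exponent `[N-1, …, 1, 0]`. -/
noncomputable def delta (N : ℕ) : Fin N →₀ ℕ :=
  Finsupp.equivFunOnFinite.symm fun i => N - 1 - (i : ℕ)

/-- The linear form on polynomials sending `x^w` to the sign of `σ` if `w` is the image of
`[N-1, …, 1, 0]` under the permutation `σ`, and to `0` if there is no such permutation. -/
noncomputable def signForm (N : ℕ) : MvPolynomial (Fin N) ℤ →ₗ[ℤ] ℤ :=
  ∑ σ : Equiv.Perm (Fin N), ((Equiv.Perm.sign σ : ℤˣ) : ℤ) • lcoeff ℤ ((delta N).mapDomain σ)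

theorem signForm_apply (N : ℕ) (p : MvPolynomial (Fin N) ℤ) :
    signForm N p = ∑ σ : Equiv.Perm (Fin N),
      ((Equiv.Perm.sign σ : ℤˣ) : ℤ) * coeff ((delta N).mapDomain σ) p := by
  simp [signForm]

theorem signForm_monomial_perm (N : ℕ) (σ : Equiv.Perm (Fin N)) :
    signForm N (monomial ((delta N).mapDomain σ) 1) = ((Equiv.Perm.sign σ : ℤˣ) : ℤ) := by
  rw [signForm_apply, Finset.sum_eq_single σ]
  · simp
  · intro τ _ hne
    rw [coeff_monomial, if_neg, mul_zero]
    intro h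
    apply hne
    ext i
    have h1 : ((delta N).mapDomain σ) (τ i) = delta N i := by
      rw [h]; exact Finsupp.mapDomain_apply τ.injective _ _
    have h2 : ((delta N).mapDomain σ) (σ (σ.symm (τ i))) = delta N (σ.symm (τ i)) :=
      Finsupp.mapDomain_apply σ.injective _ _
    rw [Equiv.apply_symm_apply] at h2
    rw [h2] at h1
    simp only [delta, Finsupp.equivFunOnFinite_symm_apply_apply] at h1
    have h3 : σ.symm (τ i) = i := by
      ext
      omega
    have h4 : τ i = σ i := by
      rw [← σ.apply_symm_apply (τ i), h3]
    rw [h4]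
  · simp

theorem signForm_monomial_of_not_perm (N : ℕ) (w : Fin N →₀ ℕ)
    (hw : ∀ σ : Equiv.Perm (Fin N), (delta N).mapDomain σ ≠ w) :
    signForm N (monomial w 1) = 0 := by
  rw [signForm_apply]
  refine Finset.sum_eq_zero fun σ _ => ?_
  rw [coeff_monomial, if_neg (hw σ).symm, mul_zero]

theorem eq_delta_of_injective {N : ℕ} {v : Fin N →₀ ℕ} (hle : v ≤ delta N)
    (hv : Function.Injective v) : v = delta N := by
  have key : ∀ m : ℕ, ∀ i : Fin N, N - 1 - (i : ℕ) = m → v i = m := by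
    intro m
    induction m using Nat.strong_induction_on with
    | _ m ih =>
      intro i hi
      have h1 : v i ≤ m := by
        have := hle i
        simp only [delta, Finsupp.equivFunOnFinite_symm_apply_apply] at this
        omega
      by_contra hne
      have hlt : v i < m := by omega
      have h2 := ih (v i) hlt ⟨N - 1 - v i, by omega⟩ (by simp only; omega)
      have h3 := hv h2
      have h4 := congrArg Fin.val h3
      simp only at h4
      omega
  ext i
  simp [delta, key _ i rfl]

theorem sum_sign_coeff_eq_zero {N : ℕ} (q : MvPolynomial (Fin N) ℤ) {v : Fin N →₀ ℕ}
    (hv : ¬ Function.Injective v) :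
    ∑ σ : Equiv.Perm (Fin N), ((Equiv.Perm.sign σ : ℤˣ) : ℤ) * coeff (v.mapDomain σ) q = 0 := by
  obtain ⟨i, j, hij, hne⟩ : ∃ i j, v i = v j ∧ i ≠ j := by
    simpa [Function.Injective] using hv
  have hsw : v.mapDomain (Equiv.swap i j) = v := by
    ext k
    have h1 : v.mapDomain (Equiv.swap i j) (Equiv.swap i j (Equiv.swap i j k))
        = v (Equiv.swap i j k) :=
      Finsupp.mapDomain_apply (Equiv.injective _) _ _
    rw [Equiv.swap_apply_self] at h1
    rw [h1]
    rcases eq_or_ne k i with rfl | hki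
    · simp [hij]
    · rcases eq_or_ne k j with rfl | hkj
      · simp [hij]
      · rw [Equiv.swap_apply_of_ne_of_ne hki hkj]
  refine Finset.sum_involution (fun σ _ => σ * Equiv.swap i j) ?_ ?_ ?_ ?_
  · intro σ _
    have h2 : v.mapDomain (σ * Equiv.swap i j) = v.mapDomain σ := by
      rw [Equiv.Perm.coe_mul, Finsupp.mapDomain_comp, hsw]
    rw [h2]
    simp [Equiv.Perm.sign_swap hne]
  · intro σ _ _ h
    have : Equiv.swap i j = 1 := by simpa using h
    exact hne (Equiv.swap_eq_one_iff.mp this)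
  · intro σ _
    exact Finset.mem_univ _
  · intro σ _
    simp [mul_assoc]

theorem signForm_mul_of_symm {N : ℕ} {p : MvPolynomial (Fin N) ℤ} (hp : p.IsSymmetric)
    (h0 : constantCoeff p = 0) (q : MvPolynomial (Fin N) ℤ) : signForm N (q * p) = 0 := by
  have h1 : ∀ σ : Equiv.Perm (Fin N), coeff ((delta N).mapDomain σ) (q * p)
      = ∑ x ∈ Finset.HasAntidiagonal.antidiagonal (delta N), coeff (x.1.mapDomain σ) q * coeff x.2 p := by
    intro σ
    have h2 : q * p = rename σ (rename σ.symm q * p) := by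
      rw [map_mul, hp σ, rename_rename]
      simp
    rw [h2, coeff_rename_mapDomain _ σ.injective, coeff_mul]
    refine Finset.sum_congr rfl fun x _ => ?_
    congr 1
    rw [← coeff_rename_mapDomain σ σ.injective (rename σ.symm q), rename_rename]
    simp
  rw [signForm_apply]
  simp_rw [h1, Finset.mul_sum]
  rw [Finset.sum_comm]
  refine Finset.sum_eq_zero fun x hx => ?_
  have hx' := Finset.HasAntidiagonal.mem_antidiagonal.mp hx
  simp_rw [← mul_assoc]
  rw [← Finset.sum_mul]
  by_cases hinj : Function.Injective x.1
  · have h3 : x.1 = delta N := eq_delta_of_injective (hx' ▸ le_self_add) hinj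
    have h4 : x.2 = 0 := by
      rw [h3] at hx'
      simpa using hx'
    rw [h4]
    rw [constantCoeff_eq] at h0
    rw [h0, mul_zero]
  · rw [sum_sign_coeff_eq_zero q hinj, zero_mul]

theorem signForm_eq_zero_of_mem {N : ℕ} {p : MvPolynomial (Fin N) ℤ} (hp : p ∈ symPlus N) :
    signForm N p = 0 := by
  suffices h : ∀ a, signForm N (a * p) = 0 by simpa using h 1
  unfold symPlus Ideal.span at hp
  induction hp using Submodule.span_induction with
  | mem x hx => exact fun a => signForm_mul_of_symm hx.1 hx.2 a
  | zero => simp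
  | add x y _ _ hx hy => intro a; rw [mul_add, map_add, hx, hy, add_zero]
  | smul b x _ hx => intro a; rw [smul_eq_mul, ← mul_assoc]; exact hx _

/-- The linear form `signForm` on the coinvariant ring. -/
noncomputable def signFormCoinv (N : ℕ) : Coinv N →ₗ[ℤ] ℤ :=
  ((symPlus N).restrictScalars ℤ).liftQ (signForm N) fun _ hp => signForm_eq_zero_of_mem hp

/-- The bilinear form `( , )^∂` on the coinvariant ring: `(f, g)^∂` depends only on the product
`f g`, and `(x^u, x^v)^∂` is the value of `signForm` at `x^(u+v)`. -/
noncomputable def form (N : ℕ) : Coinv N →ₗ[ℤ] Coinv N →ₗ[ℤ] ℤ :=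
  (LinearMap.mul ℤ (Coinv N)).compr₂ (signFormCoinv N)

theorem form_mk (N : ℕ) (p q : MvPolynomial (Fin N) ℤ) :
    form N (Ideal.Quotient.mk _ p) (Ideal.Quotient.mk _ q) = signForm N (p * q) := rfl

/-! ### The family `LK^x` -/

/-- The class of `x^{0,0,2,2,…,2n-2,2n-2}`. -/
noncomputable def LKxTop (n : ℕ) : Coinv (2 * n) :=
  Ideal.Quotient.mk _
    (monomial (Finsupp.equivFunOnFinite.symm fun p : Fin (2 * n) => 2 * ((p : ℕ) / 2)) 1)

/-- The edge of the reversed graph that erases the box `c`: the operator `-(s_i + 1)`, where `i`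
is the first label of `c`. -/
noncomputable def LKxEdge (n : ℕ) (g : Coinv (2 * n)) (c : ℕ × ℕ) : Coinv (2 * n) :=
  -(act (simpleSwap (2 * n) (content n c)) g + g)

/-- The family generated from the top element, attached to the staircase `ρ`, along the edges of
the reversed graph. The boxes of `ρ` that are not in `μ` are erased in the reverse of the row
reading; by `LKx_erase_corner` every other path from `ρ` to `μ` gives the same element. -/
noncomputable def LKx (n : ℕ) (μ : YoungDiagram) : Coinv (2 * n) :=
  ((rowReading (staircase n)).reverse.filter fun c => decide (c ∉ μ)).foldl (LKxEdge n) (LKxTop n)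

theorem mem_rowReading (μ : YoungDiagram) (c : ℕ × ℕ) : c ∈ rowReading μ ↔ c ∈ μ := by
  obtain ⟨i, j⟩ := c
  simp only [rowReading, List.mem_flatMap, List.mem_range, List.mem_map, Prod.mk.injEq]
  constructor
  · rintro ⟨a, _, b, hb, rfl, rfl⟩
    exact YoungDiagram.mem_iff_lt_rowLen.mpr hb
  · intro h
    exact ⟨i, YoungDiagram.mem_iff_lt_colLen.mp (μ.up_left_mem le_rfl (Nat.zero_le _) h), j,
      YoungDiagram.mem_iff_lt_rowLen.mp h, rfl, rfl⟩

theorem pairwise_rowReading (μ : YoungDiagram) :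
    (rowReading μ).Pairwise fun a b => a.1 < b.1 ∨ (a.1 = b.1 ∧ a.2 < b.2) := by
  rw [rowReading, List.pairwise_flatMap]
  constructor
  · intro i _
    rw [List.pairwise_map]
    exact List.pairwise_lt_range.imp fun h => Or.inr ⟨rfl, h⟩
  · refine List.pairwise_lt_range.imp fun {a b} h => ?_
    intro x hx y hy
    simp only [List.mem_map] at hx hy
    obtain ⟨_, _, rfl⟩ := hx
    obtain ⟨_, _, rfl⟩ := hy
    exact Or.inl h

theorem simpleSwap_comm (N : ℕ) {a b : ℕ} (h : a + 2 ≤ b) :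
    simpleSwap N a * simpleSwap N b = simpleSwap N b * simpleSwap N a := by
  unfold simpleSwap
  split_ifs with h1 h2
  · refine (Equiv.Perm.disjoint_iff_disjoint_support.mpr ?_).commute
    rw [Equiv.Perm.support_swap (by simp [Fin.ext_iff]; omega),
      Equiv.Perm.support_swap (by simp [Fin.ext_iff]; omega)]
    simp [Fin.ext_iff]
    omega
  all_goals simp

theorem act_act {N : ℕ} (e f : Equiv.Perm (Fin N)) (g : Coinv N) :
    act e (act f g) = act (e * f) g := by
  obtain ⟨p, rfl⟩ := Ideal.Quotient.mk_surjective g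
  simp only [act_mk, rename_rename, Equiv.Perm.coe_mul]

theorem LKxEdge_comm (n : ℕ) {c d : ℕ × ℕ} (h : content n c + 2 ≤ content n d)
    (g : Coinv (2 * n)) : LKxEdge n (LKxEdge n g c) d = LKxEdge n (LKxEdge n g d) c := by
  simp only [LKxEdge, map_neg, map_add, act_act, simpleSwap_comm (2 * n) h]
  abel

theorem foldl_LKxEdge_comm (n : ℕ) (c : ℕ × ℕ) (l : List (ℕ × ℕ))
    (h : ∀ d ∈ l, content n c + 2 ≤ content n d) (g : Coinv (2 * n)) :
    l.foldl (LKxEdge n) (LKxEdge n g c) = LKxEdge n (l.foldl (LKxEdge n) g) c := by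
  induction l generalizing g with
  | nil => rfl
  | cons d l ih =>
    simp only [List.foldl_cons]
    rw [LKxEdge_comm n (h d (by simp)), ih fun e he => h e (by simp [he])]

/-- The generation rule: erasing a corner with first label `i` applies `-(s_i + 1)`. -/
theorem LKx_erase_corner (n : ℕ) {μ ν : YoungDiagram} (hμ : μ ≤ staircase n) {c : ℕ × ℕ}
    (hc : IsCorner μ c) (hν : ν.cells = μ.cells.erase c) :
    LKx n ν = -(act (simpleSwap (2 * n) (content n c)) (LKx n μ) + LKx n μ) := by
  have hmem : ∀ d, d ∈ ν ↔ d ≠ c ∧ d ∈ μ := by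
    intro d
    rw [← YoungDiagram.mem_cells, hν, Finset.mem_erase, YoungDiagram.mem_cells]
  have hcL : c ∈ (rowReading (staircase n)).reverse := by
    rw [List.mem_reverse, mem_rowReading]
    exact hμ hc.1
  have hpw := List.pairwise_reverse.mpr (pairwise_rowReading (staircase n))
  have hsub : ∀ d ∈ (rowReading (staircase n)).reverse, d ∈ staircase n := by
    intro d hd
    rwa [List.mem_reverse, mem_rowReading] at hd
  obtain ⟨l₁, l₂, hL⟩ := List.append_of_mem hcL
  unfold LKx
  rw [hL] at hpw hsub ⊢
  rw [List.pairwise_append, List.pairwise_cons] at hpw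
  obtain ⟨-, ⟨h2, -⟩, h12⟩ := hpw
  have hf1 : l₁.filter (fun d => decide (d ∉ ν)) = l₁.filter (fun d => decide (d ∉ μ)) := by
    refine List.filter_congr fun d hd => ?_
    have hne : d ≠ c := by
      rintro rfl
      have := h12 d hd d (by simp)
      omega
    simp [hmem, hne]
  have hf2 : l₂.filter (fun d => decide (d ∉ ν)) = l₂.filter (fun d => decide (d ∉ μ)) := by
    refine List.filter_congr fun d hd => ?_
    have hne : d ≠ c := by
      rintro rfl
      have := h2 d hd
      omega
    simp [hmem, hne]
  have hcν : c ∉ ν := by simp [hmem]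
  have hcμ : ¬ c ∉ μ := not_not.mpr hc.1
  rw [List.filter_append, List.filter_append, List.filter_cons_of_pos (by simpa using hcν),
    List.filter_cons_of_neg (by simpa using hcμ), hf1, hf2, List.foldl_append, List.foldl_append,
    List.foldl_cons, foldl_LKxEdge_comm]
  · rfl
  · intro d hd
    rw [List.mem_filter] at hd
    have hdμ : d ∉ μ := by simpa using hd.2
    have hlt := h2 d hd.1
    have hdS := hsub d (by simp [hd.1])
    obtain ⟨i, j⟩ := c
    obtain ⟨i', j'⟩ := d
    simp only [content] at *
    have hdS' : i' + j' + 1 < n := by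
      rw [← YoungDiagram.mem_cells] at hdS
      simpa [staircase] using (Finset.mem_filter.mp hdS).2
    have hcS' : i + j + 1 < n := by
      have := hμ hc.1
      rw [← YoungDiagram.mem_cells] at this
      simpa [staircase] using (Finset.mem_filter.mp this).2
    have hj : ¬ (i' ≤ i ∧ j' ≤ j) := fun h => hdμ (μ.up_left_mem h.1 h.2 hc.1)
    omega

theorem LKx_staircase (n : ℕ) : LKx n (staircase n) = LKxTop n := by
  have : (rowReading (staircase n)).reverse.filter (fun c => decide (c ∉ staircase n)) = [] := by
    rw [List.filter_eq_nil_iff]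
    intro d hd
    rw [List.mem_reverse, mem_rowReading] at hd
    simpa using hd
  rw [LKx, this, List.foldl_nil]

end KLDual

/-! The proof turns the form into a pairing with noncrossing matchings. A squarefree monomial in the
`2n` variables is a set `S` of positions, and a noncrossing perfect matching `π` of `1, …, 2n` gives
the linear form reading off the coefficient of `x^S` in the product of `x_a - x_b` over the arcs `a
< b` of `π` (`bracket`, `pairing`).

The `LK` side. Against a squarefree monomial, the exponent `0,0,2,2,…` gives the form of the
matching `{1,2},{3,4},…`. Since `s_i` has adjoint `-s_i`, erasing a corner sends a linear form `φ`
to `φ ∘ s_i - φ`; by the three-term relation `bracket_swapAt` this joins `i` with `i + 1` and their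
former partners with each other. So pairing with `LK_μ` is the form of a matching whose left end
points are the vertical steps of the boundary of `μ` (`exists_matching_LKx`).

The `KL` side. It remains to pair `KL_λ` with every matching. If the openings of `π` are the
vertical steps of `λ`, the value is 1, because `KL_λ` and `bracket` are triangular in opposite
directions for the height order (`pairing_klVec_of_opens`). Otherwise it is 0
(`pairing_klVec_of_not_opens`), by induction on the removal of a rectangular block at the boundary
of `λ`. On such a block the labels `[i, k]` are those of a Yang–Baxter product, which makes `KL_λ`
invariant under the symmetric group of the window of positions covered by the block
(`swapOp_foldl_rectBoxes`, `swapOp_klVec`). If `π` has an arc inside the window, it has one joining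
neighbours there; its form is antisymmetric under that transposition while `KL_λ` is symmetric, so
the pairing vanishes. If there is no such arc, the block operators are moved onto `π` and only
re-join arcs meeting the window; a non-zero value for the smaller diagram would force the openings
of `π` to be those of `λ` (`IsNCMatching.eq_shape`).

Integrality follows from the same pairings: they are all 0 or 1, and the system giving the
coefficients of `KL_λ` from them is unitriangular over the integers (`klVec_integral`). Distinct
partitions have distinct vertical steps (`eq_of_openPos_eq`), so the pairings form the identity
matrix. -/

namespace KLDual

/-! ### Noncrossing matchings -/

/-- `π` is a noncrossing perfect matching of the positions `1, …, N`, extended by the identity. -/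
structure IsNCMatching (N : ℕ) (π : ℕ → ℕ) : Prop where
  invol : ∀ j, π (π j) = j
  ne_iff : ∀ j, π j ≠ j ↔ 1 ≤ j ∧ j ≤ N
  noncross : ∀ i j, i < j → j < π i → i < π j ∧ π j < π i

namespace IsNCMatching

variable {N : ℕ} {π : ℕ → ℕ}

theorem mem (h : IsNCMatching N π) {j : ℕ} (h1 : 1 ≤ j) (hN : j ≤ N) : 1 ≤ π j ∧ π j ≤ N := by
  rw [← h.ne_iff, h.invol]
  exact ((h.ne_iff j).2 ⟨h1, hN⟩).symm

theorem mem_of_lt (h : IsNCMatching N π) {j : ℕ} (hj : j < π j) :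
    1 ≤ j ∧ j ≤ N ∧ π j ≤ N := by
  have h1 := (h.ne_iff j).1 hj.ne'
  exact ⟨h1.1, h1.2, (h.mem h1.1 h1.2).2⟩

theorem eq_of_apply_eq (h : IsNCMatching N π) {i j : ℕ} (hij : π i = π j) : i = j := by
  rw [← h.invol i, hij, h.invol]

end IsNCMatching

/-- The matching obtained from `π` by joining `m` with `m + 1` and the partner of `m` with the
partner of `m + 1`. -/
def joinAt (π : ℕ → ℕ) (m : ℕ) : ℕ → ℕ := fun x =>
  if x = m then m + 1 else if x = m + 1 then m else if x = π m then π (m + 1)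
  else if x = π (m + 1) then π m else π x

/-- This is the Temperley–Lieb action on matchings. When `m` and `m + 1` are already joined, nothing
changes. -/
theorem IsNCMatching.joinAt {N : ℕ} {π : ℕ → ℕ} (h : IsNCMatching N π) {m : ℕ} (h1 : 1 ≤ m)
    (hN : m + 1 ≤ N) : IsNCMatching N (joinAt π m) := by
  have ha := h.invol m
  have hb := h.invol (m + 1)
  have hma := h.mem h1 (by omega : m ≤ N)
  have hmb := h.mem (by omega : 1 ≤ m + 1) hN
  have hna := (h.ne_iff m).2 ⟨h1, by omega⟩
  have hnb := (h.ne_iff (m + 1)).2 ⟨by omega, hN⟩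
  refine ⟨fun j => ?_, fun j => ?_, fun x y hxy hy => ?_⟩
  · have := h.invol j
    unfold KLDual.joinAt
    grind
  · have := h.ne_iff j
    unfold KLDual.joinAt
    grind
  · have hx := h.invol x
    have hy' := h.invol y
    -- Only `x`, `y`, `m`, `m + 1` and their partners matter, so finitely many instances of the
    -- noncrossing condition decide every case.
    have e1 := h.noncross x y
    have e2 := h.noncross x m
    have e3 := h.noncross x (m + 1)
    have e4 := h.noncross (π x) (π m)
    have e5 := h.noncross m (m+1)
    have e6 := h.noncross (π m) y
    have e7 := h.noncross (π (m+1)) y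
    have e8 := h.noncross (π (m+1)) m
    have e9 := h.noncross (π (m)) (π (m+1))
    have e10 := h.noncross (π (m+1)) (π m)
    have e11 := h.noncross m y
    have e12 := h.noncross (m+1) y
    have e13 := h.noncross (π m) x
    have e14 := h.noncross (π (m+1)) x
    have e15 := h.noncross (m) x
    have e16 := h.noncross ((m+1)) x
    have e17 := h.noncross y m
    have e18 := h.noncross y (m + 1)
    have e19 := h.noncross m (π y)
    have e20 := h.noncross (m + 1) (π y)
    have e21 := h.noncross m (π x)
    have e22 := h.noncross (m + 1) (π x)
    have e23 := h.noncross (π m) (π y)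
    have e24 := h.noncross (π (m + 1)) (π y)
    unfold KLDual.joinAt at *
    split_ifs at * <;> subst_vars <;> grind

/-! ### Brackets and the three-term relation -/

/-- The contribution of the position `j` to `bracket`. -/
def arcWeight (π : ℕ → ℕ) (S : ℕ → Bool) (j : ℕ) : ℤ :=
  if S (π j) = S j then 0 else if S j = true ∧ π j < j then -1 else 1

/-- The coefficient of the monomial with set of positions `S` in the product, over the arcs
`a < b` of `π`, of the differences `x_a - x_b`. -/
def bracket (N : ℕ) (π : ℕ → ℕ) (S : ℕ → Bool) : ℤ := ∏ j ∈ Finset.Icc 1 N, arcWeight π S j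

/-- The configuration `S` with the positions `m` and `m + 1` exchanged. -/
def swapAt (m : ℕ) (S : ℕ → Bool) : ℕ → Bool := fun j => S (Equiv.swap m (m + 1) j)

theorem swapAt_left (m : ℕ) (S : ℕ → Bool) : swapAt m S m = S (m + 1) := by simp [swapAt]

theorem swapAt_right (m : ℕ) (S : ℕ → Bool) : swapAt m S (m + 1) = S m := by simp [swapAt]

theorem swapAt_of_ne {m j : ℕ} (S : ℕ → Bool) (h : j ≠ m) (h' : j ≠ m + 1) :
    swapAt m S j = S j := by
  rw [swapAt, Equiv.swap_apply_of_ne_of_ne h h']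

variable {N : ℕ} {π : ℕ → ℕ}

/-- Coefficientwise form of `(a - c)(b - d) = (a - b)(c - d) + (a - d)(b - c)`, applied to the two
arcs that end at `m` and `m + 1`. The noncrossing condition makes all signs agree with the
orientation of arcs from left to right. -/
theorem bracket_swapAt (h : IsNCMatching N π) {m : ℕ} (h1 : 1 ≤ m) (hN : m + 1 ≤ N)
    (hm : π m ≠ m + 1) (S : ℕ → Bool) :
    bracket N π (swapAt m S) = bracket N π S + bracket N (joinAt π m) S := by
  have ha := h.invol m
  have hb := h.invol (m + 1)
  have hma := h.mem h1 (by omega : m ≤ N)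
  have hmb := h.mem (by omega : 1 ≤ m + 1) hN
  have hna := (h.ne_iff m).2 ⟨h1, by omega⟩
  have hnb := (h.ne_iff (m + 1)).2 ⟨by omega, hN⟩
  have hnc : π (m + 1) ≠ m := fun e => hm (by rw [e] at hb; omega)
  have hnd : π m ≠ π (m + 1) := fun e => by have := h.eq_of_apply_eq e; omega
  have hsub : ({m, m + 1, π m, π (m + 1)} : Finset ℕ) ⊆ Finset.Icc 1 N := by
    intro x
    simp only [Finset.mem_insert, Finset.mem_singleton, Finset.mem_Icc]
    omega
  have hout : ∀ x ∈ Finset.Icc 1 N \ {m, m + 1, π m, π (m + 1)},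
      arcWeight π (swapAt m S) x = arcWeight π S x ∧
        arcWeight (joinAt π m) S x = arcWeight π S x := by
    intro x hx
    simp only [Finset.mem_sdiff, Finset.mem_insert, Finset.mem_singleton, not_or] at hx
    obtain ⟨-, x1, x2, x3, x4⟩ := hx
    have y1 : π x ≠ m := fun e => x3 (by rw [← e, h.invol])
    have y2 : π x ≠ m + 1 := fun e => x4 (by rw [← e, h.invol])
    have y3 : joinAt π m x = π x := by simp [joinAt, x1, x2, x3, x4]
    simp only [arcWeight, swapAt_of_ne S x1 x2, swapAt_of_ne S y1 y2, y3, and_self]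
  have k0 : joinAt π m m = m + 1 := by simp [joinAt]
  have k1 : joinAt π m (m + 1) = m := by simp [joinAt]
  have k2 : joinAt π m (π m) = π (m + 1) := by simp [joinAt, hna, hm]
  have k3 : joinAt π m (π (m + 1)) = π m := by simp [joinAt, hnb, hnc, hnd.symm]
  have hloc : ∀ f : ℕ → ℤ, ∏ x ∈ ({m, m + 1, π m, π (m + 1)} : Finset ℕ), f x
      = f m * (f (m + 1) * (f (π m) * f (π (m + 1)))) := by
    intro f
    rw [Finset.prod_insert, Finset.prod_insert, Finset.prod_insert, Finset.prod_singleton] <;>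
      simp <;> omega
  unfold bracket
  rw [← Finset.prod_sdiff hsub, ← Finset.prod_sdiff hsub, ← Finset.prod_sdiff hsub,
    Finset.prod_congr rfl fun x hx => (hout x hx).1,
    Finset.prod_congr rfl fun x hx => (hout x hx).2, ← mul_add]
  congr 1
  rw [hloc, hloc, hloc]
  have n1 := h.noncross m (m + 1)
  have n2 := h.noncross (π m) m
  have n3 := h.noncross (π (m + 1)) m
  have n4 := h.noncross (π (m + 1)) (π m)
  have n5 := h.noncross (π m) (π (m + 1))
  rw [ha] at n2 n5
  rw [hb] at n3 n4
  simp only [arcWeight, ha, hb, k0, k1, k2, k3, swapAt_left, swapAt_right,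
    swapAt_of_ne S hna hm, swapAt_of_ne S hnc hnb]
  clear hout hsub hloc k0 k1 k2 k3
  generalize π m = α at *
  generalize π (m + 1) = β at *
  generalize S m = x
  generalize S (m + 1) = y
  generalize S α = z
  generalize S β = t
  -- The arcs at `m` and `m + 1` are either side by side or nested, to the left or to the right.
  have horder : (α < m ∧ m + 1 < β) ∨ (β < α ∧ α < m) ∨ (m + 1 < β ∧ β < α) := by omega
  rcases horder with ⟨o1, o2⟩ | ⟨o1, o2⟩ | ⟨o1, o2⟩
  · have q1 : ¬ m < α := by omega
    have q2 : β > m := by omega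
    have q3 : ¬ β < m := by omega
    have q4 : α < m + 1 := by omega
    have q5 : ¬ β < m + 1 := by omega
    have q6 : ¬ β < α := by omega
    have q7 : α < β := by omega
    cases x <;> cases y <;> cases z <;> cases t <;> simp [*]
  · have q1 : ¬ m < α := by omega
    have q2 : ¬ m + 1 < β := by omega
    have q3 : β < m + 1 := by omega
    have q4 : α < m + 1 := by omega
    have q6 : ¬ α < β := by omega
    cases x <;> cases y <;> cases z <;> cases t <;> simp [*]
  · have q1 : m < α := by omega
    have q2 : ¬ β < m + 1 := by omega
    have q4 : ¬ α < m := by omega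
    have q6 : ¬ α < β := by omega
    cases x <;> cases y <;> cases z <;> cases t <;> simp [*]

/-- The factor `x_m - x_{m+1}` changes sign and the other factors do not involve these variables. -/
theorem bracket_swapAt_of_arc (h : IsNCMatching N π) {m : ℕ} (h1 : 1 ≤ m) (hN : m + 1 ≤ N)
    (hm : π m = m + 1) (S : ℕ → Bool) :
    bracket N π (swapAt m S) = - bracket N π S := by
  have hb : π (m + 1) = m := by rw [← hm, h.invol]
  have hsub : ({m, m + 1} : Finset ℕ) ⊆ Finset.Icc 1 N := by
    intro x
    simp only [Finset.mem_insert, Finset.mem_singleton, Finset.mem_Icc]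
    omega
  have hout : ∀ x ∈ Finset.Icc 1 N \ {m, m + 1},
      arcWeight π (swapAt m S) x = arcWeight π S x := by
    intro x hx
    simp only [Finset.mem_sdiff, Finset.mem_insert, Finset.mem_singleton, not_or] at hx
    obtain ⟨-, x1, x2⟩ := hx
    have y1 : π x ≠ m := fun e => x2 (by rw [← hm, ← e, h.invol])
    have y2 : π x ≠ m + 1 := fun e => x1 (by rw [← hb, ← e, h.invol])
    simp only [arcWeight, swapAt_of_ne S x1 x2, swapAt_of_ne S y1 y2]
  unfold bracket
  rw [← Finset.prod_sdiff hsub, ← Finset.prod_sdiff hsub,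
    Finset.prod_congr rfl fun x hx => hout x hx, ← mul_neg]
  congr 1
  rw [Finset.prod_pair (by omega), Finset.prod_pair (by omega)]
  simp only [arcWeight, hm, hb, swapAt_left, swapAt_right]
  cases S m <;> cases S (m + 1) <;> simp

/-! ### Arcs inside a window -/

/-- A noncrossing matching with an arc inside an interval matches two neighbours there. -/
theorem IsNCMatching.exists_short_arc (h : IsNCMatching N π) {x : ℕ} (hx : x < π x) :
    ∃ m, x ≤ m ∧ m + 1 ≤ π x ∧ π m = m + 1 := by
  induction hd : π x - x using Nat.strong_induction_on generalizing x with
  | _ d ih =>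
    by_cases hs : π x = x + 1
    · exact ⟨x, le_rfl, by omega, hs⟩
    · have h1 := h.noncross x (x + 1) (by omega) (by omega)
      have h2 := h.mem_of_lt hx
      have h3 := (h.ne_iff (x + 1)).2 ⟨by omega, by omega⟩
      obtain ⟨m, hm1, hm2, hm3⟩ := ih (π (x + 1) - (x + 1)) (by omega) (by omega) rfl
      exact ⟨m, by omega, by omega, hm3⟩

/-- A run of `k` opening positions followed by a run of `k` closing positions is a nest. -/
theorem IsNCMatching.nest (h : IsNCMatching N π) {c k : ℕ}
    (hop : ∀ p, c < p + k → p ≤ c → p < π p) (hcl : ∀ p, c < p → p ≤ c + k → π p < p) {t : ℕ}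
    (ht : t < k) (htc : t < c) : π (c - t) = c + 1 + t := by
  induction t using Nat.strong_induction_on with
  | _ t ih =>
    have o1 := hop (c - t) (by omega) (by omega)
    have o2 := h.invol (c - t)
    have o3 : c < π (c - t) := by
      by_contra hlt
      have := hop (π (c - t)) (by omega) (by omega)
      omega
    have c1 := hcl (c + 1 + t) (by omega) (by omega)
    have c2 := h.invol (c + 1 + t)
    have o4 : c + 1 + t ≤ π (c - t) := by
      by_contra hlt
      have e := ih (π (c - t) - (c + 1)) (by omega) (by omega) (by omega)
      rw [show c + 1 + (π (c - t) - (c + 1)) = π (c - t) by omega] at e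
      have := h.eq_of_apply_eq e
      omega
    rcases o4.eq_or_lt with e | hlt
    · exact e.symm
    · have n1 := h.noncross (c - t) (c + 1 + t) (by omega) hlt
      rcases le_or_gt (π (c + 1 + t)) c with hle | hgt
      · have e := ih (c - π (c + 1 + t)) (by omega) (by omega) (by omega)
        rw [show c - (c - π (c + 1 + t)) = π (c + 1 + t) by omega] at e
        omega
      · have := hcl (π (c + 1 + t)) hgt (by omega)
        omega

/-- If `π` has no arc inside the window `(s, s + a + b]` and shares its arcs outside the window with
`π'`, and `π'` has `a + b` openings and then `a + b` closings around the window, then `π` has the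
same openings as `π'` outside the window, and `b` closings followed by `a` openings inside. -/
theorem IsNCMatching.eq_shape (h : IsNCMatching N π) {π' : ℕ → ℕ} (h' : IsNCMatching N π')
    {s a b : ℕ} (ha : 1 ≤ a) (hb : 1 ≤ b) (hs : b ≤ s)
    (hop : ∀ p, s < p + b → p ≤ s + a → p < π' p)
    (hcl : ∀ p, s + a < p → p ≤ s + a + b + a → π' p < p)
    (hin : ∀ p, s < p → p ≤ s + a + b → ¬ (s < π p ∧ π p ≤ s + a + b))
    (hout : ∀ p, ¬ (s < p ∧ p ≤ s + a + b) → ¬ (s < π p ∧ π p ≤ s + a + b) → π' p = π p)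
    (p : ℕ) :
    (¬ (s < p ∧ p ≤ s + a + b) → (p < π p ↔ p < π' p)) ∧
    (s < p → p ≤ s + b → π p < p) ∧
    (s + b < p → p ≤ s + a + b → p < π p) := by
  have hnest : ∀ t < a + b, π' (s + a - t) = s + a + 1 + t := fun t ht =>
    h'.nest (fun p h1 h2 => hop p (by omega) h2) (fun p h1 h2 => hcl p h1 (by omega)) ht
      (by omega)
  have hnest' : ∀ t < a + b, π' (s + a + 1 + t) = s + a - t := fun t ht => by
    rw [← hnest t ht, h'.invol]
  -- A counting argument: if this were an arc of `π`, it would enclose the whole window, and the `a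
  -- + b` partners of the window would be distinct points under the arc but outside the window.
  -- There are only `2 * t - (a + b) < a + b` of those.
  have key : ∀ t < a + b, ¬ (s < s + a - t) → ¬ (s + a + 1 + t ≤ s + a + b) →
      π (s + a - t) ≠ s + a + 1 + t := by
    intro t ht h1 h2 he
    have hmaps : ∀ w ∈ Finset.Ioc s (s + a + b),
        π w ∈ Finset.Ioo (s + a - t) (s + a + 1 + t) \ Finset.Ioc s (s + a + b) := by
      intro w hw
      rw [Finset.mem_Ioc] at hw
      have e1 := h.noncross (s + a - t) w (by omega) (by omega)
      have e2 := hin w hw.1 hw.2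
      simp only [Finset.mem_sdiff, Finset.mem_Ioo, Finset.mem_Ioc]
      omega
    have hcard := Finset.card_le_card_of_injOn π hmaps fun x _ y _ e => h.eq_of_apply_eq e
    rw [Finset.card_sdiff_of_subset] at hcard
    · simp only [Nat.card_Ioc, Nat.card_Ioo] at hcard
      omega
    · intro w
      simp only [Finset.mem_Ioo, Finset.mem_Ioc]
      omega
  -- The `b` positions just left of the window have partners inside it: a partner outside would be
  -- shared with `π'`, where it is prescribed by the nest, and `key` excludes it. The same holds for
  -- the `a` positions just to the right.
  have hL : ∀ t, t < b → s < π (s - t) ∧ π (s - t) ≤ s + a + b := by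
    intro t ht
    by_contra hc
    have e1 := hout (s - t) (by omega) hc
    have e2 := hnest (a + t) (by omega)
    rw [show s + a - (a + t) = s - t by omega] at e2
    have e3 := key (a + t) (by omega) (by omega) (by omega)
    rw [show s + a - (a + t) = s - t by omega] at e3
    omega
  have hR : ∀ t, t < a → s < π (s + a + b + 1 + t) ∧ π (s + a + b + 1 + t) ≤ s + a + b := by
    intro t ht
    by_contra hc
    have e1 := hout (s + a + b + 1 + t) (by omega) hc
    have e2 := hnest' (b + t) (by omega)
    rw [show s + a + 1 + (b + t) = s + a + b + 1 + t by omega] at e2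
    have e3 := key (b + t) (by omega) (by omega) (by omega)
    have e4 := h.invol (s + a + b + 1 + t)
    apply e3
    rw [← e2, e1, e4]
    omega
  -- Noncrossing forces the arcs across each edge of the window to be nested, so both families are
  -- reflections in the edge.
  have hLeq : ∀ t, t < b → π (s - t) = s + 1 + t := by
    intro t
    induction t using Nat.strong_induction_on with
    | _ t ih =>
      intro ht
      have l1 := hL t ht
      rcases lt_trichotomy (π (s - t)) (s + 1 + t) with hlt | heq | hgt
      · have e := ih (π (s - t) - (s + 1)) (by omega) (by omega)
        rw [show s + 1 + (π (s - t) - (s + 1)) = π (s - t) by omega] at e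
        have := h.eq_of_apply_eq e
        omega
      · exact heq
      · have e1 := h.noncross (s - t) (s + 1 + t) (by omega) hgt
        have e2 := hin (s + 1 + t) (by omega) (by omega)
        have e3 := ih (s - π (s + 1 + t)) (by omega) (by omega)
        rw [show s - (s - π (s + 1 + t)) = π (s + 1 + t) by omega, h.invol] at e3
        omega
  have hReq : ∀ t, t < a → π (s + a + b + 1 + t) = s + a + b - t := by
    intro t
    induction t using Nat.strong_induction_on with
    | _ t ih =>
      intro ht
      have l1 := hR t ht
      have l2 := h.invol (s + a + b + 1 + t)
      rcases lt_trichotomy (π (s + a + b + 1 + t)) (s + a + b - t) with hlt | heq | hgt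
      · have e1 := h.noncross (π (s + a + b + 1 + t)) (s + a + b - t) hlt (by omega)
        have e2 := hin (s + a + b - t) (by omega) (by omega)
        have e3 := ih (π (s + a + b - t) - (s + a + b + 1)) (by omega) (by omega)
        rw [show s + a + b + 1 + (π (s + a + b - t) - (s + a + b + 1)) = π (s + a + b - t) by omega,
          h.invol] at e3
        omega
      · exact heq
      · have e := ih (s + a + b - π (s + a + b + 1 + t)) (by omega) (by omega)
        rw [show s + a + b - (s + a + b - π (s + a + b + 1 + t)) = π (s + a + b + 1 + t) by omega]
          at e
        have := h.eq_of_apply_eq e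
        omega
  have hL' : ∀ q, s < q → q ≤ s + b → π q = 2 * s + 1 - q := by
    intro q h1 h2
    have e := hLeq (q - (s + 1)) (by omega)
    rw [show s + 1 + (q - (s + 1)) = q by omega] at e
    rw [← e, h.invol]
    omega
  have hR' : ∀ q, s + b < q → q ≤ s + a + b → π q = 2 * (s + a + b) + 1 - q := by
    intro q h1 h2
    have e := hReq (s + a + b - q) (by omega)
    rw [show s + a + b - (s + a + b - q) = q by omega] at e
    rw [← e, h.invol]
    omega
  refine ⟨fun hp => ?_, fun h1 h2 => ?_, fun h1 h2 => ?_⟩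
  · by_cases hw : s < π p ∧ π p ≤ s + a + b
    · have e := h.invol p
      rcases le_or_gt (π p) (s + b) with hle | hgt
      · have e1 := hL' (π p) hw.1 hle
        have e2 := hop p (by omega) (by omega)
        omega
      · have e1 := hR' (π p) hgt hw.2
        have e2 := hcl p (by omega) (by omega)
        omega
    · rw [hout p hp hw]
  · have := hL' p h1 h2
    omega
  · have := hR' p h1 h2
    omega

/-! ### Openings, heights and triangularity of brackets -/

/-- On `1, …, N`, the set `S` consists of the left end points of the arcs of `π`. -/
def Opens (N : ℕ) (π : ℕ → ℕ) (S : ℕ → Bool) : Prop :=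
  ∀ p, 1 ≤ p → p ≤ N → (S p = true ↔ p < π p)

/-- The number of positions among `1, …, p` that belong to `S`. -/
def height (S : ℕ → Bool) (p : ℕ) : ℕ := ((Finset.Icc 1 p).filter fun j => S j = true).card

theorem height_zero (S : ℕ → Bool) : height S 0 = 0 := by simp [height]

theorem height_succ (S : ℕ → Bool) (p : ℕ) :
    height S (p + 1) = height S p + if S (p + 1) = true then 1 else 0 := by
  have h : Finset.Icc 1 (p + 1) = insert (p + 1) (Finset.Icc 1 p) := by
    ext j
    simp only [Finset.mem_insert, Finset.mem_Icc]
    omega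
  rw [height, h, Finset.filter_insert]
  split_ifs with hS
  · rw [Finset.card_insert_of_notMem (by simp), height]
  · rfl

/-- The prefix `1, …, p` separates `m` from `m + 1` only for `p = m`. -/
theorem height_swapAt_of_ne {m p : ℕ} (hm : 1 ≤ m) (S : ℕ → Bool) (hp : p ≠ m) :
    height (swapAt m S) p = height S p := by
  have hlt : ∀ q, q < m → height (swapAt m S) q = height S q := by
    intro q
    induction q with
    | zero => simp [height_zero]
    | succ q ih =>
      intro hq
      rw [height_succ, height_succ, ih (by omega), swapAt_of_ne S (by omega) (by omega)]
  obtain ⟨k, rfl⟩ : ∃ k, m = k + 1 := ⟨m - 1, by omega⟩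
  have hgt : ∀ q, height (swapAt (k + 1) S) (k + 2 + q) = height S (k + 2 + q) := by
    intro q
    induction q with
    | zero =>
      rw [Nat.add_zero, height_succ, height_succ, height_succ S, height_succ S, hlt k (by omega),
        swapAt_left, swapAt_right]
      omega
    | succ q ih =>
      rw [← Nat.add_assoc, height_succ, height_succ, ih, swapAt_of_ne S (by omega) (by omega)]
  rcases Nat.lt_or_ge p (k + 1) with h | h
  · exact hlt p h
  · have := hgt (p - (k + 2))
    rwa [show k + 2 + (p - (k + 2)) = p by omega] at this

theorem height_swapAt_self (k : ℕ) (S : ℕ → Bool) :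
    height (swapAt (k + 1) S) (k + 1) = height S k + if S (k + 2) = true then 1 else 0 := by
  rw [height_succ, swapAt_left, height_swapAt_of_ne (by omega) S (by omega)]

theorem eq_of_height_eq {S T : ℕ → Bool} {N : ℕ} (h : ∀ p ≤ N, height S p = height T p) {p : ℕ}
    (h1 : 1 ≤ p) (hN : p ≤ N) : S p = T p := by
  obtain ⟨k, rfl⟩ : ∃ k, p = k + 1 := ⟨p - 1, by omega⟩
  have e1 := h k (by omega)
  have e2 := h (k + 1) hN
  rw [height_succ, height_succ, e1] at e2
  cases hS : S (k + 1) <;> cases hT : T (k + 1) <;> simp_all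

theorem ne_of_bracket_ne_zero {S : ℕ → Bool} (h : bracket N π S ≠ 0) {j : ℕ} (h1 : 1 ≤ j)
    (hN : j ≤ N) : S (π j) ≠ S j := by
  intro he
  apply h
  exact Finset.prod_eq_zero (Finset.mem_Icc.2 ⟨h1, hN⟩) (by simp [arcWeight, he])

theorem bracket_of_opens (h : IsNCMatching N π) {S : ℕ → Bool} (hS : Opens N π S) :
    bracket N π S = 1 := by
  refine Finset.prod_eq_one fun j hj => ?_
  rw [Finset.mem_Icc] at hj
  have e1 := hS j hj.1 hj.2
  have e2 := h.mem hj.1 hj.2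
  have e3 := hS (π j) e2.1 e2.2
  have e4 := (h.ne_iff j).2 hj
  rw [h.invol] at e3
  unfold arcWeight
  cases h1 : S j <;> cases h2 : S (π j) <;> simp_all <;> omega

/-- A non-zero bracket means that `S` contains exactly one end of each arc; replacing it by the left
end is injective and does not move positions to the right. -/
theorem height_le_of_bracket_ne_zero (h : IsNCMatching N π) {S T : ℕ → Bool} (hT : Opens N π T)
    (hS : bracket N π S ≠ 0) {p : ℕ} (hp : p ≤ N) : height S p ≤ height T p := by
  refine Finset.card_le_card_of_injOn (fun j => min j (π j)) (fun j hj => ?_)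
    (fun i hi j hj hij => ?_)
  · simp only [Finset.coe_filter, Finset.mem_Icc, Set.mem_ofPred_eq] at hj ⊢
    have e2 := h.mem hj.1.1 (by omega)
    have e4 := (h.ne_iff j).2 ⟨by omega, by omega⟩
    have e5 := h.invol j
    refine ⟨by omega, ?_⟩
    rcases lt_or_gt_of_ne e4 with hlt | hgt
    · rw [min_eq_right hlt.le, hT _ e2.1 e2.2]
      omega
    · rw [min_eq_left hgt.le, hT _ hj.1.1 (by omega)]
      omega
  · simp only [Finset.coe_filter, Finset.mem_Icc, Set.mem_ofPred_eq] at hi hj hij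
    have e1 := ne_of_bracket_ne_zero hS hi.1.1 (by omega)
    have e2 := h.invol i
    have e3 := h.invol j
    by_contra hne
    have e4 : π i ≠ π j := fun e => hne (h.eq_of_apply_eq e)
    have e5 : i = π j ∨ π i = j := by omega
    rcases e5 with e | e
    · rw [e, e3, hj.2, ← e, hi.2] at e1
      exact e1 rfl
    · rw [e, hj.2, hi.2] at e1
      exact e1 rfl

theorem card_closings_add_height (S : ℕ → Bool) (p : ℕ) :
    height S p + ((Finset.Icc 1 p).filter fun j => ¬ S j = true).card = p := by
  rw [height, Finset.card_filter_add_card_filter_not, Nat.card_Icc]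
  omega

/-- The ballot property: each closing among `1, …, p` has its opening there too. -/
theorem Opens.le_two_mul_height (h : IsNCMatching N π) {T : ℕ → Bool} (hT : Opens N π T) {p : ℕ}
    (hp : p ≤ N) : p ≤ 2 * height T p := by
  have h1 := card_closings_add_height T p
  have h2 : ((Finset.Icc 1 p).filter fun j => ¬ T j = true).card ≤ height T p := by
    refine Finset.card_le_card_of_injOn π (fun j hj => ?_) fun i _ j _ e => h.eq_of_apply_eq e
    simp only [Finset.coe_filter, Finset.mem_Icc, Set.mem_ofPred_eq] at hj ⊢
    have e2 := h.mem hj.1.1 (by omega)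
    have e1 := hT j hj.1.1 (by omega)
    have e3 := hT (π j) e2.1 e2.2
    have e4 := (h.ne_iff j).2 ⟨by omega, by omega⟩
    have e5 := h.invol j
    have e6 : ¬ j < π j := fun e => hj.2 (e1.2 e)
    rw [e3]
    omega
  omega

/-- Joining at a valley (closing, then opening) turns it into a peak and leaves the other openings
alone. -/
theorem Opens.joinAt (h : IsNCMatching N π) {S : ℕ → Bool} (hS : Opens N π S) {m : ℕ}
    (h1 : 1 ≤ m) (hN : m + 1 ≤ N) (hm : S m = false) (hm' : S (m + 1) = true) :
    Opens N (joinAt π m) (swapAt m S) := by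
  have hb := hS (m + 1) (by omega) hN
  have ha := hS m h1 (by omega)
  have hna := (h.ne_iff m).2 ⟨h1, by omega⟩
  have hb' := hb.1 hm'
  have ha' : ¬ m < π m := fun e => by simp [ha.2 e] at hm
  have iα := h.invol m
  have iβ := h.invol (m + 1)
  intro p p1 pN
  have hp := hS p p1 pN
  unfold KLDual.joinAt
  split_ifs with c1 c2 c3 c4
  · subst c1
    rw [swapAt_left]
    simp [hm']
  · subst c2
    rw [swapAt_right]
    simp [hm]
  · have e : π p = m := by rw [c3, iα]
    rw [swapAt_of_ne S c1 c2, hp]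
    omega
  · have e : π p = m + 1 := by rw [c4, iβ]
    rw [swapAt_of_ne S c1 c2, hp]
    omega
  · rw [swapAt_of_ne S c1 c2, hp]

/-- The matching of `1` with `2`, of `3` with `4`, and so on. -/
def pairMatching (n p : ℕ) : ℕ :=
  if 1 ≤ p ∧ p ≤ 2 * n then (if p % 2 = 1 then p + 1 else p - 1) else p

theorem isNCMatching_pairMatching (n : ℕ) : IsNCMatching (2 * n) (pairMatching n) := by
  refine ⟨fun j => ?_, fun j => ?_, fun i j hij hj => ?_⟩
  · unfold pairMatching
    split_ifs <;> omega
  · unfold pairMatching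
    split_ifs <;> omega
  · unfold pairMatching at *
    split_ifs at * <;> omega

/-- Every set of positions with the ballot property is the set of openings of a matching. -/
theorem exists_opens {n : ℕ} (S : ℕ → Bool) (hS : ∀ p ≤ 2 * n, p ≤ 2 * height S p)
    (hn : height S (2 * n) = n) : ∃ π, IsNCMatching (2 * n) π ∧ Opens (2 * n) π S := by
  -- Induction on the area under the ballot path: a highest peak is lowered to a valley, and
  -- `joinAt` raises it again.
  induction hd : ∑ p ∈ Finset.range (2 * n + 1), height S p using Nat.strong_induction_on
    generalizing S with
  | _ d ih =>
    obtain ⟨m, hm, hmax⟩ := Finset.exists_max_image (Finset.range (2 * n + 1))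
      (fun p => (2 * height S p : ℤ) - p) ⟨0, by simp⟩
    simp only [Finset.mem_range] at hm hmax
    -- If the path never exceeds level 1, it alternates. Otherwise the highest peak has level at
    -- least 2, so lowering it by 2 preserves the ballot property.
    by_cases hle : 2 * height S m ≤ m + 1
    · refine ⟨pairMatching n, isNCMatching_pairMatching n, fun p p1 pN => ?_⟩
      have e1 := hmax p (by omega)
      have e2 := hmax (p - 1) (by omega)
      have e3 := hS p (by omega)
      have e4 := hS (p - 1) (by omega)
      obtain ⟨k, rfl⟩ : ∃ k, p = k + 1 := ⟨p - 1, by omega⟩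
      have e5 := height_succ S k
      rw [Nat.add_sub_cancel] at *
      unfold pairMatching
      rw [if_pos ⟨p1, pN⟩]
      cases hk : S (k + 1) <;> simp [hk] at e5 ⊢ <;> split_ifs <;> omega
    · have hm0 : m ≠ 0 := by
        rintro rfl
        simp [height_zero] at hle
      obtain ⟨k, rfl⟩ : ∃ k, m = k + 1 := ⟨m - 1, by omega⟩
      have hm1 : k + 1 ≠ 2 * n := by
        rintro e
        rw [e, hn] at hle
        omega
      have e5 := height_succ S k
      have e6 := height_succ S (k + 1)
      have e7 := hmax k (by omega)
      have e8 := hmax (k + 2) (by omega)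
      have s1 : S (k + 1) = true := by
        by_contra hc
        rw [if_neg hc] at e5
        omega
      have s2 : S (k + 2) = false := by
        by_contra hc
        rw [if_pos (by simpa using hc), show k + 1 + 1 = k + 2 from rfl] at e6
        omega
      rw [if_pos s1] at e5
      have hself := height_swapAt_self k S
      simp only [s2, Bool.false_eq_true, if_false, add_zero] at hself
      obtain ⟨π, h1, h2⟩ := ih (∑ p ∈ Finset.range (2 * n + 1), height (swapAt (k + 1) S) p) (by
        rw [← hd]
        refine Finset.sum_lt_sum (fun p _ => ?_) ⟨k + 1, by simpa using hm, by omega⟩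
        by_cases hp : p = k + 1
        · subst hp
          omega
        · rw [height_swapAt_of_ne (by omega) S hp]) (swapAt (k + 1) S)
        (fun p hp => by
          by_cases hpk : p = k + 1
          · subst hpk
            omega
          · rw [height_swapAt_of_ne (by omega) S hpk]
            exact hS p hp)
        (by rw [height_swapAt_of_ne (by omega) S (by omega), hn]) rfl
      refine ⟨joinAt π (k + 1), h1.joinAt (by omega) (by omega), ?_⟩
      have := h2.joinAt h1 (m := k + 1) (by omega) (by omega) (by rw [swapAt_left, s2])
        (by rw [swapAt_right, s1])
      have hinv : swapAt (k + 1) (swapAt (k + 1) S) = S := by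
        funext j
        simp [swapAt]
      rwa [hinv] at this

/-- A non-zero bracket puts one end of each arc in `{1, …, n}`, and this end is then the left one.
It is the base case for the empty partition. -/
theorem bracket_initial {n : ℕ} (h : IsNCMatching (2 * n) π) {S : ℕ → Bool}
    (hS : ∀ p, 1 ≤ p → p ≤ 2 * n → (S p = true ↔ p ≤ n)) :
    (Opens (2 * n) π S → bracket (2 * n) π S = 1) ∧
      (¬ Opens (2 * n) π S → bracket (2 * n) π S = 0) := by
  refine ⟨bracket_of_opens h, fun hn => by_contra fun hb => hn fun p p1 pN => ?_⟩
  have e1 := ne_of_bracket_ne_zero hb p1 pN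
  have e2 := h.mem p1 pN
  have e3 := hS p p1 pN
  have e4 := hS (π p) e2.1 e2.2
  rw [e3]
  cases h1 : S p <;> cases h2 : S (π p) <;> simp_all
  all_goals omega

/-! ### Transpositions on formal combinations, and the pairing -/

/-- Formal linear combinations of sets of positions; a set stands for a squarefree monomial. -/
abbrev ConfigSpace (R : Type*) [CommRing R] : Type _ := (ℕ → Bool) →₀ R

section Operators

variable {R : Type*} [CommRing R]

/-- The simple transposition `s_m` acting on formal combinations of sets of positions. -/
noncomputable def swapOp (m : ℕ) : ConfigSpace R →ₗ[R] ConfigSpace R :=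
  Finsupp.lmapDomain R R (swapAt m)

theorem swapOp_single (m : ℕ) (S : ℕ → Bool) (r : R) :
    swapOp m (Finsupp.single S r) = Finsupp.single (swapAt m S) r := by
  simp [swapOp]

theorem swapAt_swapAt (m : ℕ) (S : ℕ → Bool) : swapAt m (swapAt m S) = S := by
  funext j
  simp [swapAt]

theorem swapAt_braid (m : ℕ) (S : ℕ → Bool) :
    swapAt m (swapAt (m + 1) (swapAt m S)) = swapAt (m + 1) (swapAt m (swapAt (m + 1) S)) := by
  funext j
  simp only [swapAt, Equiv.swap_apply_def]
  congr 1
  split_ifs <;> omega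

theorem swapAt_comm {a b : ℕ} (h : a + 2 ≤ b) (S : ℕ → Bool) :
    swapAt a (swapAt b S) = swapAt b (swapAt a S) := by
  funext j
  simp only [swapAt, Equiv.swap_apply_def]
  congr 1
  split_ifs <;> omega

theorem swapOp_swapOp (m : ℕ) (f : ConfigSpace R) : swapOp m (swapOp m f) = f := by
  simp only [swapOp, Finsupp.lmapDomain_apply, ← Finsupp.mapDomain_comp]
  rw [show swapAt m ∘ swapAt m = id from funext (swapAt_swapAt m), Finsupp.mapDomain_id]

theorem swapOp_braid (m : ℕ) (f : ConfigSpace R) :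
    swapOp m (swapOp (m + 1) (swapOp m f)) = swapOp (m + 1) (swapOp m (swapOp (m + 1) f)) := by
  simp only [swapOp, Finsupp.lmapDomain_apply, ← Finsupp.mapDomain_comp]
  congr 1
  exact funext (swapAt_braid m)

theorem swapOp_comm {a b : ℕ} (h : a + 2 ≤ b) (f : ConfigSpace R) :
    swapOp a (swapOp b f) = swapOp b (swapOp a f) := by
  simp only [swapOp, Finsupp.lmapDomain_apply, ← Finsupp.mapDomain_comp]
  congr 1
  exact funext (swapAt_comm h)

theorem swapOp_apply (m : ℕ) (f : ConfigSpace R) (S : ℕ → Bool) :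
    swapOp m f S = f (swapAt m S) := by
  have hinj : Function.Injective (swapAt m) := fun S T e => by
    rw [← swapAt_swapAt m S, e, swapAt_swapAt]
  conv_lhs => rw [← swapAt_swapAt m S]
  exact Finsupp.mapDomain_apply hinj _ _

/-- The linear form attached to a matching. -/
noncomputable def pairing (N : ℕ) (π : ℕ → ℕ) : ConfigSpace R →ₗ[R] R :=
  Finsupp.linearCombination R fun S => (bracket N π S : R)

theorem pairing_single (N : ℕ) (π : ℕ → ℕ) (S : ℕ → Bool) (r : R) :
    pairing N π (Finsupp.single S r) = r * (bracket N π S : R) := by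
  simp [pairing]

theorem pairing_swapOp {N : ℕ} {π : ℕ → ℕ} (h : IsNCMatching N π) {m : ℕ} (h1 : 1 ≤ m)
    (hN : m + 1 ≤ N) (hm : π m ≠ m + 1) (f : ConfigSpace R) :
    pairing N π (swapOp m f) = pairing N π f + pairing N (joinAt π m) f := by
  induction f using Finsupp.induction_linear with
  | zero => simp
  | add f g hf hg => simp only [map_add, hf, hg]; ring
  | single S r =>
    rw [swapOp_single, pairing_single, pairing_single, pairing_single,
      bracket_swapAt h h1 hN hm]
    push_cast
    ring

theorem pairing_swapOp_of_arc {N : ℕ} {π : ℕ → ℕ} (h : IsNCMatching N π) {m : ℕ} (h1 : 1 ≤ m)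
    (hN : m + 1 ≤ N) (hm : π m = m + 1) (f : ConfigSpace R) :
    pairing N π (swapOp m f) = - pairing N π f := by
  induction f using Finsupp.induction_linear with
  | zero => simp
  | add f g hf hg => simp only [map_add, hf, hg]; ring
  | single S r =>
    rw [swapOp_single, pairing_single, pairing_single, bracket_swapAt_of_arc h h1 hN hm]
    push_cast
    ring

end Operators

/-! ### Products of box operators -/

/-- The operator `f ↦ f s_i + w f` attached to a box with first label `i` and weight `w`. -/
noncomputable def boxOp (n : ℕ) (w : ℕ × ℕ → ℚ) (f : ConfigSpace ℚ) (c : ℕ × ℕ) :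
    ConfigSpace ℚ :=
  swapOp (content n c) f + w c • f

variable {n : ℕ} {w : ℕ × ℕ → ℚ}

theorem foldl_boxOp_congr {w' : ℕ × ℕ → ℚ} {l : List (ℕ × ℕ)} (h : ∀ c ∈ l, w c = w' c)
    (f : ConfigSpace ℚ) : l.foldl (boxOp n w) f = l.foldl (boxOp n w') f := by
  induction l generalizing f with
  | nil => rfl
  | cons c l ih =>
    rw [List.foldl_cons, List.foldl_cons, ih fun d hd => h d (by simp [hd]), boxOp, boxOp,
      h c (by simp)]

theorem swapOp_foldl_boxOp {m : ℕ} {l : List (ℕ × ℕ)}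
    (h : ∀ c ∈ l, content n c + 2 ≤ m ∨ m + 2 ≤ content n c) (f : ConfigSpace ℚ) :
    swapOp m (l.foldl (boxOp n w) f) = l.foldl (boxOp n w) (swapOp m f) := by
  induction l generalizing f with
  | nil => rfl
  | cons c l ih =>
    rw [List.foldl_cons, List.foldl_cons, ih fun d hd => h d (by simp [hd])]
    congr 1
    rw [boxOp, boxOp, map_add, map_smul]
    rcases h c (by simp) with hc | hc
    · rw [swapOp_comm hc]
    · rw [swapOp_comm hc]

theorem foldl_boxOp_add (l : List (ℕ × ℕ)) (f g : ConfigSpace ℚ) :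
    l.foldl (boxOp n w) (f + g) = l.foldl (boxOp n w) f + l.foldl (boxOp n w) g := by
  induction l generalizing f g with
  | nil => rfl
  | cons c l ih =>
    rw [List.foldl_cons, List.foldl_cons, List.foldl_cons, ← ih]
    congr 1
    rw [boxOp, boxOp, boxOp, map_add, smul_add]
    abel

theorem foldl_boxOp_smul (l : List (ℕ × ℕ)) (r : ℚ) (f : ConfigSpace ℚ) :
    l.foldl (boxOp n w) (r • f) = r • l.foldl (boxOp n w) f := by
  induction l generalizing f with
  | nil => rfl
  | cons c l ih =>
    rw [List.foldl_cons, List.foldl_cons, ← ih]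
    congr 1
    rw [boxOp, boxOp, map_smul, smul_add, smul_comm]

theorem boxOp_foldl_boxOp {c : ℕ × ℕ} {l : List (ℕ × ℕ)}
    (h : ∀ d ∈ l, content n d + 2 ≤ content n c ∨ content n c + 2 ≤ content n d)
    (f : ConfigSpace ℚ) :
    boxOp n w (l.foldl (boxOp n w) f) c = l.foldl (boxOp n w) (boxOp n w f c) := by
  rw [boxOp, boxOp, swapOp_foldl_boxOp h, foldl_boxOp_add, foldl_boxOp_smul]

theorem foldl_boxOp_comm {k l : List (ℕ × ℕ)}
    (h : ∀ c ∈ k, ∀ d ∈ l, content n d + 2 ≤ content n c ∨ content n c + 2 ≤ content n d)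
    (f : ConfigSpace ℚ) :
    k.foldl (boxOp n w) (l.foldl (boxOp n w) f) = l.foldl (boxOp n w) (k.foldl (boxOp n w) f) := by
  induction k generalizing f with
  | nil => rfl
  | cons c k ih =>
    rw [List.foldl_cons, List.foldl_cons, boxOp_foldl_boxOp (h c (by simp)),
      ih fun d hd => h d (by simp [hd])]

/-- Boxes may be applied last if they commute with the other boxes that follow them. -/
theorem foldl_boxOp_filter (p : ℕ × ℕ → Bool) {l : List (ℕ × ℕ)}
    (h : l.Pairwise fun c d => p c = true → p d = false →
      content n d + 2 ≤ content n c ∨ content n c + 2 ≤ content n d) (f : ConfigSpace ℚ) :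
    l.foldl (boxOp n w) f = (l.filter p).foldl (boxOp n w)
      ((l.filter fun c => !p c).foldl (boxOp n w) f) := by
  induction l generalizing f with
  | nil => rfl
  | cons c l ih =>
    rw [List.pairwise_cons] at h
    rw [List.foldl_cons, ih h.2]
    cases hc : p c
    · simp [hc]
    · simp only [List.filter_cons, hc, Bool.not_true, if_true, Bool.false_eq_true, if_false,
        List.foldl_cons]
      rw [boxOp_foldl_boxOp]
      intro d hd
      simp only [List.mem_filter, Bool.not_eq_true'] at hd
      exact h.1 d hd.1 hc hd.2

/-! ### The Yang–Baxter relation on rectangles -/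

/-- The consequence of the Yang–Baxter relation that moves `B - 1` through two factors. -/
theorem yangBaxter_invariant {V : Type*} [AddCommGroup V] [Module ℚ V] {A B : V →ₗ[ℚ] V}
    (hA : ∀ v, A (A v) = v) (hAB : ∀ v, A (B (A v)) = B (A (B v))) {u : ℚ} (hu : u ≠ 0)
    (hu' : u - 1 ≠ 0) {h : V} (hB : B h = h) :
    A (B (A h + u⁻¹ • h) + (u - 1)⁻¹ • (A h + u⁻¹ • h)) =
      B (A h + u⁻¹ • h) + (u - 1)⁻¹ • (A h + u⁻¹ • h) := by
  -- In operator form, `(A - 1)(B + 1/(u-1))(A + 1/u) = (B + 1/u)(A + 1/(u-1))(B - 1)`, and the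
  -- right side kills `h`. This scalar identity is what matches the coefficients.
  have key : u⁻¹ + (u - 1)⁻¹ * u⁻¹ = (u - 1)⁻¹ := by field_simp; ring
  simp only [map_add, map_smul, hA, hAB, hB]
  have e : (u⁻¹ + (u - 1)⁻¹ * u⁻¹) • A h = (u - 1)⁻¹ • A h := by rw [key]
  have e' : (u⁻¹ + (u - 1)⁻¹ * u⁻¹) • h = (u - 1)⁻¹ • h := by rw [key]
  rw [add_smul, mul_smul] at e e'
  rw [smul_add, smul_add, ← e, ← e']
  abel

/-- Along a row or column of a rectangle the weights are `1/u, 1/(u-1), …`, so passing through the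
chain turns invariance under the transposition of box `k + 1` into invariance under that of box `k`.
Only these two boxes interact; the earlier ones commute with the first transposition and the later
ones with the second. -/
theorem swapOp_foldl_chain (box : ℕ → ℕ × ℕ) {b k : ℕ} {u : ℚ} (hu : (b : ℚ) ≤ u)
    (hw : ∀ j < b, w (box j) = (u - j)⁻¹) (hk : k + 1 < b)
    (hadj : content n (box k) + 1 = content n (box (k + 1)) ∨
      content n (box (k + 1)) + 1 = content n (box k))
    (hlt : ∀ j < k, content n (box j) + 2 ≤ content n (box (k + 1)) ∨
      content n (box (k + 1)) + 2 ≤ content n (box j))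
    (hgt : ∀ j, k + 1 < j → j < b → content n (box j) + 2 ≤ content n (box k) ∨
      content n (box k) + 2 ≤ content n (box j))
    {g : ConfigSpace ℚ} (hg : swapOp (content n (box (k + 1))) g = g) :
    swapOp (content n (box k)) (((List.range b).map box).foldl (boxOp n w) g) =
      ((List.range b).map box).foldl (boxOp n w) g := by
  obtain ⟨t, rfl⟩ : ∃ t, b = k + 2 + t := ⟨b - (k + 2), by omega⟩
  clear hk
  induction t with
  | zero =>
    rw [Nat.add_zero] at *
    simp only [List.range_succ, List.map_append, List.map_cons, List.map_nil, List.foldl_append,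
      List.foldl_cons, List.foldl_nil]
    set h := ((List.range k).map box).foldl (boxOp n w) g with hh
    have hh' : swapOp (content n (box (k + 1))) h = h := by
      rw [hh, swapOp_foldl_boxOp, hg]
      intro c hc
      simp only [List.mem_map, List.mem_range] at hc
      obtain ⟨j, hj, rfl⟩ := hc
      exact hlt j hj
    push_cast at hu
    have w1 := hw k (by omega)
    have w2 := hw (k + 1) (by omega)
    rw [show u - ((k + 1 : ℕ) : ℚ) = u - k - 1 by push_cast; ring] at w2
    unfold boxOp
    rw [w1, w2]
    refine yangBaxter_invariant (swapOp_swapOp _) (fun v => ?_) (by linarith) (by linarith) hh'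
    rcases hadj with e | e
    · rw [← e, swapOp_braid]
    · rw [← e, swapOp_braid]
  | succ t ih =>
    rw [show k + 2 + (t + 1) = k + 2 + t + 1 by omega, List.range_succ, List.map_append,
      List.foldl_append, List.map_cons, List.map_nil, List.foldl_cons, List.foldl_nil]
    push_cast at hu
    have := ih (by push_cast; linarith) (fun j hj => hw j (by omega))
      (fun j h1 h2 => hgt j h1 (by omega))
    rw [boxOp, map_add, map_smul, this]
    rcases hgt (k + 2 + t) (by omega) (by omega) with e | e
    · rw [← swapOp_comm e, this]
    · rw [swapOp_comm e, this]

/-- The boxes of a rectangle with `a` rows and `b` columns and first box `(r, c)`, by rows. -/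
def rectBoxes (r a c b : ℕ) : List (ℕ × ℕ) :=
  (List.range a).flatMap fun i => (List.range b).map fun j => (r + i, c + j)

theorem foldl_rectBoxes_succ_row (r a c b : ℕ) (f : ConfigSpace ℚ) :
    (rectBoxes r (a + 1) c b).foldl (boxOp n w) f =
      ((List.range b).map fun j => (r + a, c + j)).foldl (boxOp n w)
        ((rectBoxes r a c b).foldl (boxOp n w) f) := by
  simp [rectBoxes, List.range_succ, List.flatMap_append, List.foldl_append]

/-- A rectangle may also be read by columns: a new row commutes with the part of the last column
above it, their contents differing by at least 2. -/
theorem foldl_rectBoxes_succ_col {r a c : ℕ} (b : ℕ) (h : r + a ≤ n) (f : ConfigSpace ℚ) :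
    (rectBoxes r a c (b + 1)).foldl (boxOp n w) f =
      ((List.range a).map fun i => (r + i, c + b)).foldl (boxOp n w)
        ((rectBoxes r a c b).foldl (boxOp n w) f) := by
  induction a with
  | zero => simp [rectBoxes]
  | succ a ih =>
    rw [foldl_rectBoxes_succ_row, foldl_rectBoxes_succ_row, ih (by omega), List.range_succ,
      List.range_succ, List.map_append, List.map_append, List.foldl_append, List.foldl_append,
      foldl_boxOp_comm (k := (List.range b).map fun j => (r + a, c + j))]
    · rfl
    · intro d hd e he
      simp only [List.mem_map, List.mem_range] at hd he
      obtain ⟨j, hj, rfl⟩ := hd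
      obtain ⟨i, hi, rfl⟩ := he
      simp only [content]
      omega

/-- The product over a rectangle turns invariance under the two factors of the Young subgroup into
invariance under the whole symmetric group of the window. -/
theorem swapOp_foldl_rectBoxes {r a c b : ℕ} (ha : 1 ≤ a) (hb : 1 ≤ b) (hn : r + a ≤ n)
    (hw : ∀ i < a, ∀ j < b, w (r + i, c + j) = ((a + b - 1 : ℚ) - i - j)⁻¹)
    {f : ConfigSpace ℚ} (hf : ∀ m, n + c + 1 ≤ m + r + a → m + r < n + c + b → m + r ≠ n + c →
      swapOp m f = f) {m : ℕ} (h1 : n + c + 1 ≤ m + r + a) (h2 : m + r < n + c + b) :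
    swapOp m ((rectBoxes r a c b).foldl (boxOp n w) f) =
      (rectBoxes r a c b).foldl (boxOp n w) f := by
  -- Each row shifts the transpositions of the right Young factor one step down.
  have hrow : ∀ a', a' ≤ a → ∀ m, n + c + 1 ≤ m + r + a' → m + r + a' < n + c + b →
      swapOp m ((rectBoxes r a' c b).foldl (boxOp n w) f) =
        (rectBoxes r a' c b).foldl (boxOp n w) f := by
    intro a'
    induction a' with
    | zero => exact fun _ m h1 h2 => hf m (by omega) (by omega) (by omega)
    | succ a' ih =>
      intro ha' m h1 h2
      obtain ⟨k, hk⟩ : ∃ k, m + r + a' = n + c + k := ⟨m + r + a' - (n + c), by omega⟩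
      have hm : m = content n (r + a', c + k) := by simp only [content]; omega
      have hm' : m + 1 = content n (r + a', c + (k + 1)) := by simp only [content]; omega
      have hprev := ih (by omega) (m + 1) (by omega) (by omega)
      rw [foldl_rectBoxes_succ_row]
      rw [hm'] at hprev
      rw [hm]
      refine swapOp_foldl_chain (fun j => (r + a', c + j)) (u := (a + b - 1 : ℚ) - a') ?_
        (fun j hj => hw a' (by omega) j hj) (by omega) ?_ ?_ ?_ hprev
      · have : (a' + 1 : ℚ) ≤ a := by exact_mod_cast ha'
        linarith
      all_goals simp only [content]
      all_goals intros
      all_goals omega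
  -- Symmetrically, each column shifts those of the left factor one step up.
  have hcol : ∀ b', b' ≤ b → ∀ m, n + c + b' + 1 ≤ m + r + a → m + r < n + c + b' →
      swapOp m ((rectBoxes r a c b').foldl (boxOp n w) f) =
        (rectBoxes r a c b').foldl (boxOp n w) f := by
    intro b'
    induction b' with
    | zero =>
      intro _ m h1 h2
      rw [show rectBoxes r a c 0 = [] by simp [rectBoxes, List.flatMap_eq_nil_iff]]
      exact hf m (by omega) (by omega) (by omega)
    | succ b' ih =>
      intro hb' m h1 h2
      obtain ⟨k, hk⟩ : ∃ k, m + r + k = n + c + b' := ⟨n + c + b' - (m + r), by omega⟩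
      have hm : m = content n (r + k, c + b') := by simp only [content]; omega
      have hm' : m - 1 = content n (r + (k + 1), c + b') := by simp only [content]; omega
      have hprev := ih (by omega) (m - 1) (by omega) (by omega)
      rw [foldl_rectBoxes_succ_col b' hn]
      rw [hm'] at hprev
      rw [hm]
      refine swapOp_foldl_chain (fun i => (r + i, c + b')) (u := (a + b - 1 : ℚ) - b') ?_
        (fun i hi => ?_) (by omega) ?_ ?_ ?_ hprev
      · have : (b' + 1 : ℚ) ≤ b := by exact_mod_cast hb'
        linarith
      · rw [hw i hi b' (by omega), sub_right_comm]
      all_goals simp only [content]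
      all_goals intros
      all_goals omega
  rcases lt_trichotomy (m + r + a) (n + c + b) with hlt | heq | hgt
  · exact hrow a le_rfl m h1 hlt
  · obtain ⟨a, rfl⟩ : ∃ k, a = k + 1 := ⟨a - 1, by omega⟩
    obtain ⟨b, rfl⟩ : ∃ k, b = k + 1 := ⟨b - 1, by omega⟩
    -- The one transposition reached by neither shift is that of the last box, which has weight 1:
    -- the product ends with `s_m + 1`.
    have hm : content n (r + a, c + b) = m := by simp only [content]; omega
    have hw1 : w (r + a, c + b) = 1 := by
      rw [hw a (by omega) b (by omega)]
      push_cast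
      ring_nf
    rw [foldl_rectBoxes_succ_row, List.range_succ, List.map_append, List.foldl_append,
      List.map_cons, List.map_nil, List.foldl_cons, List.foldl_nil, boxOp, hm, hw1, one_smul,
      map_add, swapOp_swapOp, add_comm]
  · exact hcol b le_rfl m (by omega) h2

theorem mem_of_le_staircase {n : ℕ} {μ : YoungDiagram} (hμ : μ ≤ staircase n) {i j : ℕ}
    (h : (i, j) ∈ μ) : i + j + 1 < n := by
  have := hμ h
  rw [← YoungDiagram.mem_cells] at this
  simpa [staircase] using (Finset.mem_filter.mp this).2

/-! ### The second label -/

theorem mem_eraseCorners {μ : YoungDiagram} {c : ℕ × ℕ} :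
    c ∈ eraseCorners μ ↔ (c.1 + 1, c.2) ∈ μ ∨ (c.1, c.2 + 1) ∈ μ := by
  rw [← YoungDiagram.mem_cells, eraseCorners]
  simp only [Finset.mem_filter, YoungDiagram.mem_cells]
  refine ⟨fun h => h.2, fun h => ⟨?_, h⟩⟩
  rcases h with h | h
  · exact μ.up_left_mem (Nat.le_succ _) le_rfl h
  · exact μ.up_left_mem le_rfl (Nat.le_succ _) h

/-- A box survives `k` erasures iff some right/down path of length `k` from it stays in `μ`; thus
the second label is the length of a longest such path. -/
theorem mem_iterate_eraseCorners {μ : YoungDiagram} {c : ℕ × ℕ} {k : ℕ} :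
    c ∈ eraseCorners^[k] μ ↔ ∃ x y, x + y = k ∧ (c.1 + x, c.2 + y) ∈ μ := by
  induction k generalizing c with
  | zero =>
    constructor
    · exact fun h => ⟨0, 0, rfl, h⟩
    · rintro ⟨x, y, hxy, h⟩
      obtain ⟨rfl, rfl⟩ : x = 0 ∧ y = 0 := by omega
      exact h
  | succ k ih =>
    rw [Function.iterate_succ_apply', mem_eraseCorners, ih, ih]
    constructor
    · rintro (⟨x, y, h, hm⟩ | ⟨x, y, h, hm⟩)
      · exact ⟨x + 1, y, by omega, by simpa [add_assoc, add_comm, add_left_comm] using hm⟩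
      · exact ⟨x, y + 1, by omega, by simpa [add_assoc, add_comm, add_left_comm] using hm⟩
    · rintro ⟨x, y, h, hm⟩
      rcases x with _ | x
      · obtain ⟨y, rfl⟩ : ∃ z, y = z + 1 := ⟨y - 1, by omega⟩
        exact Or.inr ⟨0, y, by omega, by simpa [add_assoc, add_comm, add_left_comm] using hm⟩
      · exact Or.inl ⟨x, y, by omega, by simpa [add_assoc, add_comm, add_left_comm] using hm⟩

theorem depth_eq {μ : YoungDiagram} {c : ℕ × ℕ} {k : ℕ}
    (h1 : ∀ x y, (c.1 + x, c.2 + y) ∈ μ → x + y ≤ k)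
    (h2 : ∃ x y, x + y = k ∧ (c.1 + x, c.2 + y) ∈ μ) : depth μ c = k := by
  refine le_antisymm (Nat.sInf_le ?_) (le_csInf ⟨k, ?_⟩ ?_)
  · rw [Set.mem_ofPred_eq, mem_iterate_eraseCorners]
    rintro ⟨x, y, hxy, h⟩
    have := h1 x y h
    omega
  · rw [Set.mem_ofPred_eq, mem_iterate_eraseCorners]
    rintro ⟨x, y, hxy, h⟩
    have := h1 x y h
    omega
  · intro l hl
    rw [Set.mem_ofPred_eq, mem_iterate_eraseCorners] at hl
    by_contra hlt
    apply hl
    obtain ⟨x, y, hxy, h⟩ := h2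
    exact ⟨min x (l + 1), l + 1 - min x (l + 1), by omega,
      μ.up_left_mem (by omega) (by omega) h⟩

theorem depth_congr {μ ν : YoungDiagram} {c : ℕ × ℕ}
    (h : ∀ x y, (c.1 + x, c.2 + y) ∈ μ → ∃ x' y', x' + y' = x + y ∧ (c.1 + x', c.2 + y') ∈ ν)
    (h' : ν ≤ μ) : depth μ c = depth ν c := by
  unfold depth
  congr 1
  ext k
  rw [Set.mem_ofPred_eq, Set.mem_ofPred_eq, mem_iterate_eraseCorners, mem_iterate_eraseCorners,
    not_iff_not]
  constructor
  · rintro ⟨x, y, hxy, hm⟩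
    obtain ⟨x', y', e, hm'⟩ := h x y hm
    exact ⟨x', y', by omega, hm'⟩
  · rintro ⟨x, y, hxy, hm⟩
    exact ⟨x, y, hxy, h' hm⟩

/-! ### Row readings -/

/-- The order of the boxes in the row reading. -/
def RowLT (a b : ℕ × ℕ) : Prop := a.1 < b.1 ∨ (a.1 = b.1 ∧ a.2 < b.2)

theorem eq_of_pairwise_rowLT {k l : List (ℕ × ℕ)} (hk : k.Pairwise RowLT) (hl : l.Pairwise RowLT)
    (h : ∀ c, c ∈ k ↔ c ∈ l) : k = l := by
  have hne : ∀ {m : List (ℕ × ℕ)}, m.Pairwise RowLT → m.Nodup := fun hm =>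
    hm.imp fun {a b} hab he => by
      subst he
      unfold RowLT at hab
      omega
  refine List.Perm.eq_of_pairwise (le := RowLT) (fun a b _ _ h1 h2 => ?_) hk hl
    ((List.perm_ext_iff_of_nodup (hne hk) (hne hl)).2 h)
  unfold RowLT at h1 h2
  omega

theorem pairwise_rectBoxes (r a c b : ℕ) : (rectBoxes r a c b).Pairwise RowLT := by
  rw [rectBoxes, List.pairwise_flatMap]
  constructor
  · intro i _
    rw [List.pairwise_map]
    exact List.pairwise_lt_range.imp fun h => Or.inr ⟨rfl, by simpa using h⟩
  · refine List.pairwise_lt_range.imp fun {i i'} h => ?_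
    intro x hx y hy
    simp only [List.mem_map] at hx hy
    obtain ⟨_, _, rfl⟩ := hx
    obtain ⟨_, _, rfl⟩ := hy
    exact Or.inl (by simpa using h)

theorem mem_rectBoxes {r a c b i j : ℕ} :
    (i, j) ∈ rectBoxes r a c b ↔ (r ≤ i ∧ i < r + a) ∧ c ≤ j ∧ j < c + b := by
  simp only [rectBoxes, List.mem_flatMap, List.mem_range, List.mem_map, Prod.mk.injEq]
  constructor
  · rintro ⟨x, hx, y, hy, rfl, rfl⟩
    omega
  · rintro ⟨⟨h1, h2⟩, h3, h4⟩
    exact ⟨i - r, by omega, j - c, by omega, by omega, by omega⟩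

theorem ne_bot_iff_exists_mem {μ : YoungDiagram} : μ ≠ ⊥ ↔ ∃ c, c ∈ μ := by
  constructor
  · intro h
    by_contra hc
    push Not at hc
    apply h
    refine le_bot_iff.1 fun c hcm => absurd hcm (hc c)
  · rintro ⟨c, hc⟩ rfl
    exact YoungDiagram.notMem_bot c hc

theorem rowReading_bot : rowReading ⊥ = [] :=
  List.eq_nil_iff_forall_not_mem.2 fun c hc =>
    YoungDiagram.notMem_bot c ((mem_rowReading _ _).1 hc)

/-- The last box read is a corner, which allows induction one box at a time. -/
theorem exists_rowReading_eq_append {μ : YoungDiagram} (hμ : μ ≠ ⊥) :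
    ∃ (ν : YoungDiagram) (c : ℕ × ℕ), IsCorner μ c ∧ ν.cells = μ.cells.erase c ∧
      rowReading μ = rowReading ν ++ [c] := by
  obtain ⟨d, hd⟩ := ne_bot_iff_exists_mem.1 hμ
  have hne : rowReading μ ≠ [] := List.ne_nil_of_mem ((mem_rowReading μ d).2 hd)
  obtain ⟨l, c, hl⟩ := (List.eq_nil_or_concat' _).resolve_left hne
  have hpw := pairwise_rowReading μ
  rw [hl, List.pairwise_append] at hpw
  obtain ⟨hpl, -, hlc⟩ := hpw
  have hmem : ∀ d, d ∈ μ ↔ d ∈ l ∨ d = c := fun d => by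
    rw [← mem_rowReading, hl, List.mem_append, List.mem_singleton]
  have hlast : ∀ d ∈ μ, d ≠ c → RowLT d c := fun d hd hdc =>
    hlc d (((hmem d).1 hd).resolve_right hdc) c (by simp)
  have hcl : c ∉ l := fun h => by
    have := hlc c h c (by simp)
    omega
  have hc : c ∈ μ := (hmem c).2 (Or.inr rfl)
  have hlow : IsLowerSet ((μ.cells.erase c : Finset (ℕ × ℕ)) : Set (ℕ × ℕ)) := by
    rintro x y hyx hx
    simp only [Finset.coe_erase, Set.mem_sdiff, Finset.mem_coe, YoungDiagram.mem_cells,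
      Set.mem_singleton_iff] at hx ⊢
    refine ⟨μ.isLowerSet hyx hx.1, ?_⟩
    rintro rfl
    have h1 := hlast x hx.1 hx.2
    have h2 : y.1 ≤ x.1 ∧ y.2 ≤ x.2 := hyx
    unfold RowLT at h1
    omega
  refine ⟨⟨μ.cells.erase c, hlow⟩, c, ⟨hc, fun h => ?_, fun h => ?_⟩, rfl, ?_⟩
  · have h1 := hlast _ h fun e => by have := congrArg Prod.fst e; simp at this
    simp only [RowLT] at h1
    omega
  · have h1 := hlast _ h fun e => by have := congrArg Prod.snd e; simp at this
    simp only [RowLT] at h1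
    omega
  · rw [hl]
    congr 1
    refine eq_of_pairwise_rowLT hpl (pairwise_rowReading _) fun d => ?_
    rw [mem_rowReading, ← YoungDiagram.mem_cells, Finset.mem_erase, YoungDiagram.mem_cells, hmem]
    constructor
    · intro h
      exact ⟨fun e => hcl (e ▸ h), Or.inl h⟩
    · rintro ⟨h1, h2⟩
      exact h2.resolve_right h1

theorem le_of_cells_eq_erase {μ ν : YoungDiagram} {c : ℕ × ℕ} (h : ν.cells = μ.cells.erase c) :
    ν ≤ μ := by
  rw [← YoungDiagram.cells_subset_iff, h]
  exact Finset.erase_subset _ _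

theorem exists_add_corner {μ κ : YoungDiagram} (hle : μ ≤ κ) (hne : μ ≠ κ) :
    ∃ (ν : YoungDiagram) (c : ℕ × ℕ), ν ≤ κ ∧ IsCorner ν c ∧ μ.cells = ν.cells.erase c := by
  have hnon : (κ.cells \ μ.cells).Nonempty := by
    rw [Finset.sdiff_nonempty, YoungDiagram.cells_subset_iff]
    exact fun h => hne (le_antisymm hle h)
  obtain ⟨c, hc, hmin⟩ := Finset.exists_min_image _ (fun c : ℕ × ℕ => c.1 + c.2) hnon
  simp only [Finset.mem_sdiff, YoungDiagram.mem_cells] at hc hmin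
  have hlow : IsLowerSet ((insert c μ.cells : Finset (ℕ × ℕ)) : Set (ℕ × ℕ)) := by
    rintro x y hyx hx
    simp only [Finset.coe_insert, Set.mem_insert_iff, Finset.mem_coe,
      YoungDiagram.mem_cells] at hx ⊢
    rcases hx with rfl | hx
    · by_contra hy
      rw [not_or] at hy
      have h1 := hmin y ⟨κ.isLowerSet hyx hc.1, hy.2⟩
      have h2 : y.1 ≤ x.1 ∧ y.2 ≤ x.2 := hyx
      exact hy.1 (Prod.ext (by omega) (by omega))
    · exact Or.inr (μ.isLowerSet hyx hx)
  have hmem : ∀ d, d ∈ (⟨insert c μ.cells, hlow⟩ : YoungDiagram) ↔ d = c ∨ d ∈ μ := fun d => by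
    rw [← YoungDiagram.mem_cells, Finset.mem_insert, YoungDiagram.mem_cells]
  refine ⟨⟨insert c μ.cells, hlow⟩, c, ?_, ⟨(hmem c).2 (Or.inl rfl), ?_, ?_⟩, ?_⟩
  · intro d hd
    rcases (hmem d).1 hd with rfl | h
    · exact hc.1
    · exact hle h
  · rw [hmem]
    rintro (h | h)
    · have := congrArg Prod.fst h
      simp at this
    · exact hc.2 (μ.up_left_mem (Nat.le_succ _) le_rfl h)
  · rw [hmem]
    rintro (h | h)
    · have := congrArg Prod.snd h
      simp at this
    · exact hc.2 (μ.up_left_mem le_rfl (Nat.le_succ _) h)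
  · exact (Finset.erase_insert (by simpa using hc.2)).symm

/-! ### The sets of positions attached to partitions -/

/-- The set of positions of the vertical steps of the boundary of `μ`, where the columns of `μ`
give the horizontal steps. -/
def openPos (n : ℕ) (μ : YoungDiagram) (p : ℕ) : Bool :=
  decide (∃ i < n, p + i = n + μ.rowLen i)

theorem openPos_eq_true_iff {n : ℕ} {μ : YoungDiagram} {p : ℕ} :
    openPos n μ p = true ↔ ∃ i < n, p + i = n + μ.rowLen i := by simp [openPos]

theorem openPos_of_row {n : ℕ} {μ : YoungDiagram} {p i : ℕ} (hi : i < n)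
    (h : p + i = n + μ.rowLen i) : openPos n μ p = true :=
  openPos_eq_true_iff.2 ⟨i, hi, h⟩

/-- Horizontal and vertical steps occupy different positions of the boundary, read from the lower
left to the upper right. -/
theorem openPos_of_col {n : ℕ} {μ : YoungDiagram} {p j : ℕ}
    (h : p + μ.colLen j = n + 1 + j) : openPos n μ p = false := by
  rw [← Bool.not_eq_true, openPos_eq_true_iff]
  rintro ⟨i, hi, he⟩
  have h1 : j < μ.rowLen i ↔ i < μ.colLen j := by
    rw [← YoungDiagram.mem_iff_lt_rowLen, YoungDiagram.mem_iff_lt_colLen]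
  omega

theorem rowLen_eq_of_mem {μ : YoungDiagram} {i k : ℕ} (h1 : 0 < k → (i, k - 1) ∈ μ)
    (h2 : (i, k) ∉ μ) : μ.rowLen i = k := by
  rw [YoungDiagram.mem_iff_lt_rowLen] at h1 h2
  omega

theorem colLen_eq_of_mem {μ : YoungDiagram} {j k : ℕ} (h1 : 0 < k → (k - 1, j) ∈ μ)
    (h2 : (k, j) ∉ μ) : μ.colLen j = k := by
  rw [YoungDiagram.mem_iff_lt_colLen] at h1 h2
  omega

theorem rowLen_congr {μ ν : YoungDiagram} {i : ℕ} (h : ∀ j, (i, j) ∈ μ ↔ (i, j) ∈ ν) :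
    μ.rowLen i = ν.rowLen i := by
  refine eq_of_forall_lt_iff fun j => ?_
  rw [← YoungDiagram.mem_iff_lt_rowLen, ← YoungDiagram.mem_iff_lt_rowLen, h]

theorem rowLen_lt_of_le_staircase {n : ℕ} {μ : YoungDiagram} (hμ : μ ≤ staircase n) {i : ℕ}
    (hi : i < n) : μ.rowLen i + i < n := by
  by_contra h
  have := mem_of_le_staircase hμ
    ((YoungDiagram.mem_iff_lt_rowLen (μ := μ) (i := i) (j := n - 1 - i)).2 (by omega))
  omega

theorem openPos_eq_false_of_gt {n : ℕ} {μ : YoungDiagram} (hμ : μ ≤ staircase n) {p : ℕ}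
    (hp : p = 0 ∨ 2 * n < p) : openPos n μ p = false := by
  rw [← Bool.not_eq_true, openPos_eq_true_iff]
  rintro ⟨i, hi, he⟩
  have := rowLen_lt_of_le_staircase hμ hi
  omega

theorem openPos_bot (n p : ℕ) : openPos n ⊥ p = true ↔ 1 ≤ p ∧ p ≤ n := by
  have h0 : ∀ i, (⊥ : YoungDiagram).rowLen i = 0 := fun i =>
    rowLen_eq_of_mem (by omega) (YoungDiagram.notMem_bot _)
  rw [openPos_eq_true_iff]
  constructor
  · rintro ⟨i, hi, he⟩
    rw [h0] at he
    omega
  · rintro ⟨h1, h2⟩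
    exact ⟨n - p, by omega, by rw [h0]; omega⟩

theorem one_le_content {n : ℕ} {μ : YoungDiagram} (hμ : μ ≤ staircase n) {c : ℕ × ℕ}
    (hc : c ∈ μ) : 1 ≤ content n c ∧ content n c + 1 ≤ 2 * n := by
  obtain ⟨i, j⟩ := c
  have := mem_of_le_staircase hμ hc
  simp only [content]
  omega

/-- A corner of content `m` is a horizontal step at `m` followed by a vertical one at `m + 1`;
erasing it exchanges the two. -/
theorem openPos_of_erase {n : ℕ} {μ ν : YoungDiagram} (hμ : μ ≤ staircase n) {c : ℕ × ℕ}
    (hc : IsCorner μ c) (hν : ν.cells = μ.cells.erase c) :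
    openPos n ν (content n c) = true ∧ openPos n ν (content n c + 1) = false ∧
      openPos n μ = swapAt (content n c) (openPos n ν) := by
  have hmem : ∀ d, d ∈ ν ↔ d ≠ c ∧ d ∈ μ := by
    intro d
    rw [← YoungDiagram.mem_cells, hν, Finset.mem_erase, YoungDiagram.mem_cells]
  obtain ⟨r, j⟩ := c
  obtain ⟨c1, c2, c3⟩ := hc
  simp only at c2 c3
  have hr := mem_of_le_staircase hμ c1
  have rμ : μ.rowLen r = j + 1 := rowLen_eq_of_mem (by simpa using c1) c3
  have cμ : μ.colLen j = r + 1 := colLen_eq_of_mem (by simpa using c1) c2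
  have rν : ν.rowLen r = j := by
    refine rowLen_eq_of_mem (fun h => ?_) (by simp [hmem])
    rw [hmem]
    exact ⟨by simp; omega, μ.up_left_mem le_rfl (by omega) c1⟩
  have cν : ν.colLen j = r := by
    refine colLen_eq_of_mem (fun h => ?_) (by simp [hmem])
    rw [hmem]
    exact ⟨by simp; omega, μ.up_left_mem (by omega) le_rfl c1⟩
  have rne : ∀ i, i ≠ r → ν.rowLen i = μ.rowLen i := fun i hi =>
    rowLen_congr fun k => by simp [hmem, hi]
  have hm : content n (r, j) + r = n + j := by simp only [content]; omega
  generalize content n (r, j) = m at *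
  have e1 : openPos n ν m = true := openPos_of_row (i := r) (by omega) (by omega)
  have e2 : openPos n ν (m + 1) = false := openPos_of_col (j := j) (by omega)
  have e3 : openPos n μ m = false := openPos_of_col (j := j) (by omega)
  have e4 : openPos n μ (m + 1) = true := openPos_of_row (i := r) (by omega) (by omega)
  refine ⟨e1, e2, funext fun p => ?_⟩
  by_cases p1 : p = m
  · rw [p1, swapAt_left, e2, e3]
  by_cases p2 : p = m + 1
  · rw [p2, swapAt_right, e1, e4]
  rw [swapAt_of_ne _ p1 p2, Bool.eq_iff_iff, openPos_eq_true_iff, openPos_eq_true_iff]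
  refine exists_congr fun i => and_congr_right fun hi => ?_
  by_cases hir : i = r
  · subst hir
    omega
  · rw [rne i hir]

theorem openPos_staircase (n : ℕ) {p : ℕ} (h1 : 1 ≤ p) (hN : p ≤ 2 * n) :
    openPos n (staircase n) p = true ↔ p % 2 = 1 := by
  have hrow : ∀ i < n, (staircase n).rowLen i = n - 1 - i := fun i hi => by
    have hm : ∀ j, (i, j) ∈ staircase n ↔ i + j + 1 < n := fun j => by
      rw [← YoungDiagram.mem_cells]
      simp only [staircase, Finset.mem_filter, Finset.mem_product, Finset.mem_range]
      omega
    refine rowLen_eq_of_mem (fun h => ?_) ?_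
    · rw [hm]
      omega
    · rw [hm]
      omega
  rw [openPos_eq_true_iff]
  constructor
  · rintro ⟨i, hi, he⟩
    rw [hrow i hi] at he
    omega
  · intro h
    refine ⟨(2 * n - 1 - p) / 2, by omega, ?_⟩
    rw [hrow _ (by omega)]
    omega

/-- Positions of vertical steps decrease strictly with the row, so rows can be recovered from the
first one on. -/
theorem rowLen_le_of_openPos_le {n : ℕ} {μ ν : YoungDiagram}
    (h : ∀ p, openPos n μ p = true → openPos n ν p = true) {i : ℕ} (hi : i < n)
    (hlt : ∀ k < i, μ.rowLen k = ν.rowLen k) (hμ : μ.rowLen i + i < n) :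
    μ.rowLen i ≤ ν.rowLen i := by
  obtain ⟨k, hk, he⟩ := openPos_eq_true_iff.1
    (h (n + μ.rowLen i - i) (openPos_of_row hi (by omega)))
  rcases Nat.lt_or_ge k i with hki | hki
  · have h1 := hlt k hki
    have h2 := μ.rowLen_anti k i hki.le
    omega
  · have h2 := ν.rowLen_anti i k hki
    omega

theorem eq_of_openPos_eq {n : ℕ} {μ ν : YoungDiagram} (hμ : μ ≤ staircase n)
    (hν : ν ≤ staircase n) (h : ∀ p, openPos n μ p = openPos n ν p) : μ = ν := by
  have hrow : ∀ i < n, μ.rowLen i = ν.rowLen i := by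
    intro i
    induction i using Nat.strong_induction_on with
    | _ i ih =>
      intro hi
      refine le_antisymm ?_ ?_
      · exact rowLen_le_of_openPos_le (fun p hp => by rw [← h, hp]) hi
          (fun k hk => ih k hk (by omega)) (rowLen_lt_of_le_staircase hμ hi)
      · exact rowLen_le_of_openPos_le (fun p hp => by rw [h, hp]) hi
          (fun k hk => (ih k hk (by omega)).symm) (rowLen_lt_of_le_staircase hν hi)
  refine YoungDiagram.ext (Finset.ext fun ⟨i, j⟩ => ?_)
  rw [YoungDiagram.mem_cells, YoungDiagram.mem_cells]
  by_cases hi : i < n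
  · rw [YoungDiagram.mem_iff_lt_rowLen, YoungDiagram.mem_iff_lt_rowLen, hrow i hi]
  · constructor
    · intro hm
      have := mem_of_le_staircase hμ hm
      omega
    · intro hm
      have := mem_of_le_staircase hν hm
      omega

/-! ### Erasing a block -/

/-- The rectangle with rows `r, …, r'` and columns `c, …, c'` is a block at the lower right
boundary of `μ`, whose neighbouring blocks are at least as long as the adjacent sides. -/
structure IsBlock (μ : YoungDiagram) (r r' c c' : ℕ) : Prop where
  le_row : r ≤ r'
  le_col : c ≤ c'
  mem : (r', c') ∈ μ
  notMem_below : (r' + 1, c) ∉ μ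
  notMem_right : (r, c' + 1) ∉ μ
  mem_left : 0 < c → (r' + 1 + c' - c, c - 1) ∈ μ
  mem_above : 0 < r → (r - 1, c' + 1 + r' - r) ∈ μ

/-- Take the maximal rectangle ending at a corner with `i + j` least. The neighbouring corners have
at least the same sum, which is exactly what makes the adjacent boundary runs long enough. -/
theorem exists_isBlock {μ : YoungDiagram} (hμ : μ ≠ ⊥) : ∃ r r' c c', IsBlock μ r r' c c' := by
  obtain ⟨d, hd⟩ := ne_bot_iff_exists_mem.1 hμ
  obtain ⟨e, he, hmax⟩ := Finset.exists_max_image μ.cells (fun c : ℕ × ℕ => c.1 + c.2)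
    ⟨d, by simpa using hd⟩
  simp only [YoungDiagram.mem_cells] at he hmax
  classical
  obtain ⟨⟨r', c'⟩, hx, hmin⟩ := Finset.exists_min_image (μ.cells.filter fun c => IsCorner μ c)
    (fun c : ℕ × ℕ => c.1 + c.2) ⟨e, by
      simp only [Finset.mem_filter, YoungDiagram.mem_cells]
      refine ⟨he, he, fun h => ?_, fun h => ?_⟩
      · have := hmax _ h
        simp only at this
        omega
      · have := hmax _ h
        simp only at this
        omega⟩
  simp only [Finset.mem_filter, YoungDiagram.mem_cells] at hx hmin
  obtain ⟨hm, -, hbel, hrig⟩ := hx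
  have b1 := hbel
  have b2 := hrig
  have b3 := hm
  have b4 := hm
  simp only at b1 b2
  rw [YoungDiagram.mem_iff_lt_rowLen] at b1 b3
  rw [YoungDiagram.mem_iff_lt_colLen] at b2 b4
  refine ⟨μ.colLen (c' + 1), r', μ.rowLen (r' + 1), c', by omega, by omega, hm, ?_, ?_, ?_, ?_⟩
  · rw [YoungDiagram.mem_iff_lt_rowLen]
    omega
  · rw [YoungDiagram.mem_iff_lt_colLen]
    omega
  · intro hc
    have h1 : (r' + 1, μ.rowLen (r' + 1) - 1) ∈ μ := by
      rw [YoungDiagram.mem_iff_lt_rowLen]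
      omega
    have h2 := h1
    rw [YoungDiagram.mem_iff_lt_colLen] at h2
    set q := μ.colLen (μ.rowLen (r' + 1) - 1) with hq
    have h3 : (q - 1, μ.rowLen (r' + 1) - 1) ∈ μ := by
      rw [YoungDiagram.mem_iff_lt_colLen]
      omega
    have h4 := hmin (q - 1, μ.rowLen (r' + 1) - 1) ⟨h3, h3, by
      rw [YoungDiagram.mem_iff_lt_colLen]
      simp only
      omega, fun h => by
        have h5 := μ.up_left_mem (by omega : r' + 1 ≤ q - 1)
          (by simp only; omega : μ.rowLen (r' + 1) ≤ _) h
        rw [YoungDiagram.mem_iff_lt_rowLen] at h5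
        omega⟩
    simp only at h4
    exact μ.up_left_mem (by omega) le_rfl h3
  · intro hc
    have h1 : (μ.colLen (c' + 1) - 1, c' + 1) ∈ μ := by
      rw [YoungDiagram.mem_iff_lt_colLen]
      omega
    have h2 := h1
    rw [YoungDiagram.mem_iff_lt_rowLen] at h2
    set q := μ.rowLen (μ.colLen (c' + 1) - 1) with hq
    have h3 : (μ.colLen (c' + 1) - 1, q - 1) ∈ μ := by
      rw [YoungDiagram.mem_iff_lt_rowLen]
      omega
    have h4 := hmin (μ.colLen (c' + 1) - 1, q - 1) ⟨h3, h3, fun h => by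
        have h5 := μ.up_left_mem (by simp only; omega : μ.colLen (c' + 1) ≤ _)
          (by omega : c' + 1 ≤ q - 1) h
        rw [YoungDiagram.mem_iff_lt_colLen] at h5
        omega, by
      rw [YoungDiagram.mem_iff_lt_rowLen]
      simp only
      omega⟩
    simp only at h4
    exact μ.up_left_mem le_rfl (by omega) h3

/-- The diagram of the boxes of `μ` that are above row `r` or to the left of column `c`. -/
def eraseQuadrant (μ : YoungDiagram) (r c : ℕ) : YoungDiagram where
  cells := μ.cells.filter fun d => d.1 < r ∨ d.2 < c
  isLowerSet := by
    rintro ⟨i, j⟩ ⟨i', j'⟩ ⟨h1, h2⟩ h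
    simp only [Finset.coe_filter, YoungDiagram.mem_cells, Set.mem_ofPred_eq] at h h1 h2 ⊢
    exact ⟨μ.up_left_mem h1 h2 h.1, by omega⟩

theorem mem_eraseQuadrant {μ : YoungDiagram} {r c i j : ℕ} :
    (i, j) ∈ eraseQuadrant μ r c ↔ (i, j) ∈ μ ∧ (i < r ∨ j < c) := by
  rw [← YoungDiagram.mem_cells, eraseQuadrant]
  simp

theorem eraseQuadrant_le (μ : YoungDiagram) (r c : ℕ) : eraseQuadrant μ r c ≤ μ := by
  rw [← YoungDiagram.cells_subset_iff]
  exact Finset.filter_subset _ _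

namespace IsBlock

variable {μ : YoungDiagram} {r r' c c' : ℕ}

theorem mem_iff (h : IsBlock μ r r' c c') {i j : ℕ} (hi : r ≤ i) (hj : c ≤ j) :
    (i, j) ∈ μ ↔ i ≤ r' ∧ j ≤ c' := by
  constructor
  · intro hm
    constructor
    · by_contra hlt
      exact h.notMem_below (μ.up_left_mem (by omega) hj hm)
    · by_contra hlt
      exact h.notMem_right (μ.up_left_mem hi (by omega) hm)
  · exact fun hm => μ.up_left_mem hm.1 hm.2 h.mem

theorem card_lt (h : IsBlock μ r r' c c') : (eraseQuadrant μ r c).cells.card < μ.cells.card := by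
  refine Finset.card_lt_card ⟨Finset.filter_subset _ _, fun hs => ?_⟩
  have := hs (by simpa using h.mem)
  rw [YoungDiagram.mem_cells, mem_eraseQuadrant] at this
  have h1 := h.le_row
  have h2 := h.le_col
  omega

theorem depth_of_mem (h : IsBlock μ r r' c c') {i j : ℕ} (hi : r ≤ i) (hj : c ≤ j)
    (hi' : i ≤ r') (hj' : j ≤ c') : depth μ (i, j) = (r' - i) + (c' - j) := by
  refine depth_eq (fun x y hxy => ?_) ⟨r' - i, c' - j, rfl, ?_⟩
  · rw [h.mem_iff (by simp only; omega) (by simp only; omega)] at hxy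
    simp only at hxy
    omega
  · rw [h.mem_iff (by simp only; omega) (by simp only; omega)]
    simp only
    omega

/-- A path that enters the block can be rerouted, with the same length, through column `c - 1` or
row `r - 1`, which are long enough by `mem_left` and `mem_above`. So erasing the block does not
change the remaining labels. -/
theorem depth_of_notMem (h : IsBlock μ r r' c c') {d : ℕ × ℕ} (hd : d ∈ eraseQuadrant μ r c) :
    depth μ d = depth (eraseQuadrant μ r c) d := by
  obtain ⟨i, j⟩ := d
  rw [mem_eraseQuadrant] at hd
  refine depth_congr (fun x y hxy => ?_) (eraseQuadrant_le _ _ _)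
  simp only at hxy ⊢
  by_cases hq : i + x < r ∨ j + y < c
  · exact ⟨x, y, rfl, mem_eraseQuadrant.2 ⟨hxy, hq⟩⟩
  rw [not_or, not_lt, not_lt] at hq
  rw [h.mem_iff hq.1 hq.2] at hxy
  have l1 := h.le_row
  have l2 := h.le_col
  by_cases hj : j < c
  · have hl := h.mem_left (by omega)
    refine ⟨x + y - min y (c - 1 - j), min y (c - 1 - j), by omega, mem_eraseQuadrant.2 ⟨?_, ?_⟩⟩
    · exact μ.up_left_mem (by omega) (by omega) hl
    · omega
  · have hl := h.mem_above (by omega)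
    refine ⟨min x (r - 1 - i), x + y - min x (r - 1 - i), by omega, mem_eraseQuadrant.2 ⟨?_, ?_⟩⟩
    · exact μ.up_left_mem (by omega) (by omega) hl
    · omega

theorem filter_rowReading (h : IsBlock μ r r' c c') :
    (rowReading μ).filter (fun d => decide (r ≤ d.1 ∧ c ≤ d.2)) =
      rectBoxes r (r' + 1 - r) c (c' + 1 - c) := by
  refine eq_of_pairwise_rowLT ((pairwise_rowReading μ).filter _) (pairwise_rectBoxes _ _ _ _) ?_
  rintro ⟨i, j⟩
  rw [List.mem_filter, mem_rowReading, mem_rectBoxes, decide_eq_true_eq]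
  have l1 := h.le_row
  have l2 := h.le_col
  constructor
  · rintro ⟨h1, h2, h3⟩
    rw [h.mem_iff h2 h3] at h1
    omega
  · rintro h1
    rw [h.mem_iff (by omega) (by omega)]
    simp only
    omega

theorem filter_not_rowReading (μ : YoungDiagram) (r c : ℕ) :
    (rowReading μ).filter (fun d => !decide (r ≤ d.1 ∧ c ≤ d.2)) =
      rowReading (eraseQuadrant μ r c) := by
  refine eq_of_pairwise_rowLT ((pairwise_rowReading μ).filter _) (pairwise_rowReading _) ?_
  rintro ⟨i, j⟩
  rw [List.mem_filter, mem_rowReading, mem_rowReading, mem_eraseQuadrant, Bool.not_eq_true',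
    decide_eq_false_iff_not]
  refine and_congr_right fun _ => ?_
  simp only
  omega

end IsBlock

/-! ### The vectors `KL` -/

/-- The weight of a box of `μ` in the definition of `KLx`. -/
noncomputable def boxWeight (μ : YoungDiagram) (c : ℕ × ℕ) : ℚ := (1 + (depth μ c : ℚ))⁻¹

/-- The formal combination of sets of positions obtained by reading the boxes of `μ`. -/
noncomputable def klVec (n : ℕ) (w : ℕ × ℕ → ℚ) (μ : YoungDiagram) : ConfigSpace ℚ :=
  (rowReading μ).foldl (boxOp n w) (Finsupp.single (openPos n ⊥) 1)

/-- A box read after one of the block but outside it lies strictly lower and strictly left, so the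
contents differ by at least 2 and the block can be applied last. -/
theorem IsBlock.klVec_eq {n : ℕ} {μ : YoungDiagram} {r r' c c' : ℕ} (h : IsBlock μ r r' c c')
    (hμ : μ ≤ staircase n) : klVec n (boxWeight μ) μ =
      (rectBoxes r (r' + 1 - r) c (c' + 1 - c)).foldl (boxOp n (boxWeight μ))
        (klVec n (boxWeight (eraseQuadrant μ r c)) (eraseQuadrant μ r c)) := by
  rw [klVec, foldl_boxOp_filter (fun d => decide (r ≤ d.1 ∧ c ≤ d.2)), h.filter_rowReading,
    IsBlock.filter_not_rowReading, klVec]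
  · congr 1
    refine foldl_boxOp_congr (fun d hd => ?_) _
    rw [mem_rowReading] at hd
    rw [boxWeight, boxWeight, h.depth_of_notMem hd]
  · refine (List.pairwise_iff_forall_sublist.2 fun {x y} hs => ?_)
    intro hx hy
    have hxm : x ∈ μ := (mem_rowReading μ x).1 (hs.subset (by simp))
    have hym : y ∈ μ := (mem_rowReading μ y).1 (hs.subset (by simp))
    have hlt := List.pairwise_iff_forall_sublist.1 (pairwise_rowReading μ) hs
    obtain ⟨i, j⟩ := x
    obtain ⟨i', j'⟩ := y
    rw [decide_eq_true_eq] at hx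
    rw [decide_eq_false_iff_not] at hy
    have h1 := mem_of_le_staircase hμ hxm
    have h2 := mem_of_le_staircase hμ hym
    simp only [content] at *
    omega

namespace IsBlock

variable {n : ℕ} {μ : YoungDiagram} {r r' c c' : ℕ}

theorem row_bound (h : IsBlock μ r r' c c') (hμ : μ ≤ staircase n) :
    r' + 1 + c' + 1 ≤ n + c := by
  have h1 := mem_of_le_staircase hμ h.mem
  have h2 := h.le_col
  rcases Nat.eq_zero_or_pos c with h0 | h0
  · omega
  · have := mem_of_le_staircase hμ (h.mem_left h0)
    omega

/-- With `a` rows and `b` columns in the block, the smaller diagram has `a + b` vertical steps and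
then `a + b` horizontal ones around the first content of the block. This is where `mem_left` and
`mem_above` are used. -/
theorem openPos_erase_true (h : IsBlock μ r r' c c') (hμ : μ ≤ staircase n) {p : ℕ}
    (h1 : n + 2 * c < p + r' + c' + 2) (h2 : p + r ≤ n + c) :
    openPos n (eraseQuadrant μ r c) p = true := by
  have l1 := h.le_row
  have l2 := h.le_col
  have l3 := h.row_bound hμ
  have e : (eraseQuadrant μ r c).rowLen (n + c - p) = c := by
    refine rowLen_eq_of_mem (fun hc => ?_) ?_
    · rw [mem_eraseQuadrant]
      exact ⟨μ.up_left_mem (by omega) le_rfl (h.mem_left hc), by omega⟩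
    · rw [mem_eraseQuadrant]
      omega
  exact openPos_of_row (i := n + c - p) (by omega) (by omega)

theorem openPos_erase_false (h : IsBlock μ r r' c c') {p : ℕ}
    (h1 : n + c < p + r) (h2 : p + 2 * r ≤ n + c' + r' + 2) :
    openPos n (eraseQuadrant μ r c) p = false := by
  have l1 := h.le_row
  have l2 := h.le_col
  have e : (eraseQuadrant μ r c).colLen (p + r - (n + 1)) = r := by
    refine colLen_eq_of_mem (fun hr => ?_) ?_
    · rw [mem_eraseQuadrant]
      exact ⟨μ.up_left_mem le_rfl (by omega) (h.mem_above hr), by omega⟩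
    · rw [mem_eraseQuadrant]
      omega
  exact openPos_of_col (j := p + r - (n + 1)) (by omega)

theorem openPos_false (h : IsBlock μ r r' c c') {p : ℕ} (h1 : n + c < p + r' + 1)
    (h2 : p + r' ≤ n + c') : openPos n μ p = false := by
  have e : μ.colLen (p + r' - n) = r' + 1 := by
    refine colLen_eq_of_mem (fun _ => ?_) fun hm => ?_
    · exact μ.up_left_mem (by omega) (by omega) h.mem
    · exact h.notMem_below (μ.up_left_mem (by omega) (by omega) hm)
  exact openPos_of_col (j := p + r' - n) (by omega)

theorem openPos_true (h : IsBlock μ r r' c c') (hμ : μ ≤ staircase n) {p : ℕ}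
    (h1 : n + c' < p + r') (h2 : p + r ≤ n + c' + 1) : openPos n μ p = true := by
  have l3 := mem_of_le_staircase hμ h.mem
  have e : μ.rowLen (n + c' + 1 - p) = c' + 1 := by
    refine rowLen_eq_of_mem (fun _ => ?_) fun hm => ?_
    · exact μ.up_left_mem (by omega) (by omega) h.mem
    · exact h.notMem_right (μ.up_left_mem (by omega) (by omega) hm)
  exact openPos_of_row (i := n + c' + 1 - p) (by omega) (by omega)

theorem openPos_erase_eq (h : IsBlock μ r r' c c') {p : ℕ}
    (hp : ¬ (n + c < p + r' + 1 ∧ p + r ≤ n + c' + 1)) :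
    openPos n (eraseQuadrant μ r c) p = openPos n μ p := by
  have l1 := h.le_row
  have l2 := h.le_col
  rw [Bool.eq_iff_iff, openPos_eq_true_iff, openPos_eq_true_iff]
  refine exists_congr fun i => and_congr_right fun hi => ?_
  by_cases hir : r ≤ i ∧ i ≤ r'
  · have e1 : μ.rowLen i = c' + 1 := rowLen_eq_of_mem
      (fun _ => μ.up_left_mem hir.2 le_rfl h.mem)
      (fun hm => h.notMem_right (μ.up_left_mem hir.1 le_rfl hm))
    have e2 : (eraseQuadrant μ r c).rowLen i = c := rowLen_eq_of_mem
      (fun _ => by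
        rw [mem_eraseQuadrant]
        exact ⟨μ.up_left_mem hir.2 (by omega) h.mem, by omega⟩)
      (by rw [mem_eraseQuadrant]; omega)
    rw [e1, e2]
    omega
  · rw [rowLen_congr (ν := μ)]
    intro j
    rw [mem_eraseQuadrant]
    refine ⟨fun hm => hm.1, fun hm => ⟨hm, ?_⟩⟩
    by_contra hc
    have := (h.mem_iff (i := i) (j := j) (by omega) (by omega)).1 hm
    omega

end IsBlock

theorem boxWeight_rect {μ : YoungDiagram} {r r' c c' : ℕ} (h : IsBlock μ r r' c c') :
    ∀ i < r' + 1 - r, ∀ j < c' + 1 - c, boxWeight μ (r + i, c + j) =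
      ((((r' + 1 - r : ℕ) : ℚ) + ((c' + 1 - c : ℕ) : ℚ) - 1 : ℚ) - i - j)⁻¹ := by
  intro i hi j hj
  have l1 := h.le_row
  have l2 := h.le_col
  rw [boxWeight, h.depth_of_mem (by omega) (by omega) (by omega) (by omega)]
  congr 1
  have e : ((r' - (r + i) + (c' - (c + j)) : ℕ) : ℚ) + 2 + i + j =
      ((r' + 1 - r : ℕ) : ℚ) + ((c' + 1 - c : ℕ) : ℚ) := by
    norm_cast
    omega
  rw [← e]
  ring

/-- `KL` is invariant under the simple transpositions that do not exchange an opening position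
with a following closing position. -/
theorem swapOp_klVec {n : ℕ} {μ : YoungDiagram} (hμ : μ ≤ staircase n) {m : ℕ} (h1 : 1 ≤ m)
    (hN : m + 1 ≤ 2 * n) (hm : ¬ (openPos n μ m = true ∧ openPos n μ (m + 1) = false)) :
    swapOp m (klVec n (boxWeight μ) μ) = klVec n (boxWeight μ) μ := by
  induction hd : μ.cells.card using Nat.strong_induction_on generalizing μ m with
  | _ d ih =>
    by_cases hbot : μ = ⊥
    · subst hbot
      rw [klVec, rowReading_bot, List.foldl_nil, swapOp_single]
      congr 1
      rw [← Bool.not_eq_true (openPos n ⊥ (m + 1)), openPos_bot, openPos_bot] at hm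
      funext p
      by_cases p1 : p = m
      · subst p1
        rw [swapAt_left, Bool.eq_iff_iff, openPos_bot, openPos_bot]
        omega
      by_cases p2 : p = m + 1
      · subst p2
        rw [swapAt_right, Bool.eq_iff_iff, openPos_bot, openPos_bot]
        omega
      rw [swapAt_of_ne _ p1 p2]
    · obtain ⟨r, r', c, c', h⟩ := exists_isBlock hbot
      have l1 := h.le_row
      have l2 := h.le_col
      have l3 := h.row_bound hμ
      have l4 := mem_of_le_staircase hμ h.mem
      have hν : eraseQuadrant μ r c ≤ staircase n := (eraseQuadrant_le μ r c).trans hμ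
      have hrec : ∀ k, 1 ≤ k → k + 1 ≤ 2 * n →
          ¬ (openPos n (eraseQuadrant μ r c) k = true ∧
            openPos n (eraseQuadrant μ r c) (k + 1) = false) →
          swapOp k (klVec n (boxWeight (eraseQuadrant μ r c)) (eraseQuadrant μ r c)) =
            klVec n (boxWeight (eraseQuadrant μ r c)) (eraseQuadrant μ r c) :=
        fun k k1 k2 k3 => ih _ (hd ▸ h.card_lt) hν k1 k2 k3 rfl
      rw [h.klVec_eq hμ]
      -- Inside the window the rectangle supplies the invariance. At either edge `μ` has an opening
      -- followed by a closing, which is excluded; farther away `s_m` commutes with the block.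
      by_cases hwin : n + c + 1 ≤ m + r' + 1 ∧ m + r < n + c' + 1
      · refine swapOp_foldl_rectBoxes (by omega) (by omega) (by omega) (boxWeight_rect h)
          (fun k k1 k2 k3 => hrec k (by omega) (by omega) ?_) (by omega) (by omega)
        rcases lt_or_gt_of_ne k3 with hlt | hgt
        · rw [h.openPos_erase_true hμ (p := k + 1) (by omega) (by omega)]
          simp
        · rw [h.openPos_erase_false (p := k) (by omega) (by omega)]
          simp
      · have hs : m + r' + 1 ≠ n + c := fun e => hm ⟨by
          rw [← h.openPos_erase_eq (by omega)]
          exact h.openPos_erase_true hμ (by omega) (by omega),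
          h.openPos_false (by omega) (by omega)⟩
        have he : m + r ≠ n + c' + 1 := fun e => hm ⟨h.openPos_true hμ (by omega) (by omega), by
          rw [← h.openPos_erase_eq (by omega)]
          exact h.openPos_erase_false (by omega) (by omega)⟩
        rw [swapOp_foldl_boxOp, hrec m h1 hN]
        · rwa [h.openPos_erase_eq (by omega), h.openPos_erase_eq (by omega)]
        · rintro ⟨i, j⟩ hd
          rw [mem_rectBoxes] at hd
          simp only [content]
          omega

/-! ### Triangularity -/

/-- The support of `KL_μ` lies below the set of positions of `μ`, which has coefficient one. -/
theorem klVec_triangular {n : ℕ} (w : ℕ × ℕ → ℚ) {μ : YoungDiagram} (hμ : μ ≤ staircase n) :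
    klVec n w μ (openPos n μ) = 1 ∧ ∀ S, klVec n w μ S ≠ 0 →
      (∀ p, height (openPos n μ) p ≤ height S p) ∧ height S (2 * n) = n ∧
        ∀ p, p = 0 ∨ 2 * n < p → S p = false := by
  induction hd : μ.cells.card using Nat.strong_induction_on generalizing μ with
  | _ d ih =>
    by_cases hbot : μ = ⊥
    · subst hbot
      rw [klVec, rowReading_bot, List.foldl_nil]
      refine ⟨Finsupp.single_eq_same, fun S hS => ?_⟩
      obtain rfl : S = openPos n ⊥ := by
        by_contra hne
        exact hS (Finsupp.single_eq_of_ne hne)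
      refine ⟨fun _ => le_rfl, ?_, fun p hp => openPos_eq_false_of_gt hμ hp⟩
      rw [height, show ((Finset.Icc 1 (2 * n)).filter fun j => openPos n ⊥ j = true) =
        Finset.Icc 1 n from ?_, Nat.card_Icc, Nat.add_sub_cancel]
      ext p
      rw [Finset.mem_filter, openPos_bot, Finset.mem_Icc, Finset.mem_Icc]
      omega
    · obtain ⟨ν, c, hc, hν, hread⟩ := exists_rowReading_eq_append hbot
      have hνμ := le_of_cells_eq_erase hν
      obtain ⟨i1, i2⟩ := ih ν.cells.card (by
        rw [← hd, hν]
        exact Finset.card_erase_lt_of_mem (by simpa using hc.1)) (hνμ.trans hμ) rfl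
      obtain ⟨o1, o2, o3⟩ := openPos_of_erase hμ hc hν
      obtain ⟨m1, m2⟩ := one_le_content hμ hc.1
      have hkl : klVec n w μ = boxOp n w (klVec n w ν) c := by
        rw [klVec, hread, List.foldl_append]
        rfl
      rw [hkl]
      obtain ⟨k, hk⟩ : ∃ k, content n c = k + 1 := ⟨content n c - 1, by omega⟩
      simp only [boxOp, Finsupp.add_apply, Finsupp.smul_apply, swapOp_apply, smul_eq_mul]
      rw [hk] at o1 o2 o3 m1 m2 ⊢
      have hself := height_swapAt_self k (openPos n ν)
      rw [show k + 2 = k + 1 + 1 from rfl, o2] at hself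
      simp only [Bool.false_eq_true, if_false, add_zero] at hself
      have hsucc := height_succ (openPos n ν) k
      rw [if_pos o1] at hsucc
      have hle : ∀ p, height (openPos n μ) p ≤ height (openPos n ν) p := by
        intro p
        by_cases hp : p = k + 1
        · rw [o3, hp]
          omega
        · rw [o3, height_swapAt_of_ne (by omega) _ hp]
      constructor
      · rw [o3, swapAt_swapAt, i1]
        -- The swapped set has smaller height at `k + 1` than the set of `ν`, hence lies outside the
        -- support.
        have : klVec n w ν (swapAt (k + 1) (openPos n ν)) = 0 := by
          by_contra hne
          have := (i2 _ hne).1 (k + 1)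
          omega
        rw [this]
        ring
      · intro S hS
        by_cases hS' : klVec n w ν S = 0
        · rw [hS', mul_zero, add_zero] at hS
          obtain ⟨j1, j2, j3⟩ := i2 _ hS
          refine ⟨fun p => ?_, ?_, fun p hp => ?_⟩
          · by_cases hp : p = k + 1
            · subst hp
              have e1 := j1 k
              rw [height_swapAt_of_ne (by omega) _ (by omega)] at e1
              have e2 := height_succ S k
              rw [o3]
              omega
            · have e1 := j1 p
              rw [height_swapAt_of_ne (by omega) _ hp] at e1
              exact (hle p).trans e1
          · rw [height_swapAt_of_ne (by omega) _ (by omega)] at j2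
            exact j2
          · have := j3 p hp
            rwa [swapAt_of_ne _ (by omega) (by omega)] at this
        · obtain ⟨j1, j2, j3⟩ := i2 S hS'
          exact ⟨fun p => (hle p).trans (j1 p), j2, j3⟩

theorem opens_eq_of_bracket_ne_zero {n : ℕ} {π : ℕ → ℕ} (h : IsNCMatching (2 * n) π)
    {S T : ℕ → Bool} (hT : Opens (2 * n) π T) (hST : ∀ p, height T p ≤ height S p)
    (hout : ∀ p, p = 0 ∨ 2 * n < p → S p = T p) (hS : bracket (2 * n) π S ≠ 0) : S = T := by
  funext p
  by_cases hp : p = 0 ∨ 2 * n < p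
  · exact hout p hp
  · exact eq_of_height_eq (N := 2 * n)
      (fun q hq => le_antisymm (height_le_of_bracket_ne_zero h hT hS hq) (hST q))
      (by omega) (by omega)

theorem pairing_eq_sum {R : Type*} [CommRing R] (N : ℕ) (π : ℕ → ℕ) (f : ConfigSpace R) :
    pairing N π f = ∑ S ∈ f.support, f S * (bracket N π S : R) := by
  rw [pairing, Finsupp.linearCombination_apply, Finsupp.sum]
  rfl

/-- Support of `KL` has heights at least those of `μ`, non-zero brackets have heights at most those:
only the set of `μ` itself contributes. The weights play no role. -/
theorem pairing_klVec_of_opens {n : ℕ} {μ : YoungDiagram} (hμ : μ ≤ staircase n) {π : ℕ → ℕ}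
    (h : IsNCMatching (2 * n) π) (hop : Opens (2 * n) π (openPos n μ)) (w : ℕ × ℕ → ℚ) :
    pairing (2 * n) π (klVec n w μ) = 1 := by
  obtain ⟨t1, t2⟩ := klVec_triangular w hμ
  rw [pairing_eq_sum, Finset.sum_eq_single (openPos n μ), t1, bracket_of_opens h hop]
  · simp
  · intro S hS hne
    obtain ⟨j1, j2, j3⟩ := t2 S (Finsupp.mem_support_iff.1 hS)
    by_contra hb
    refine hne (opens_eq_of_bracket_ne_zero h hop j1 (fun p hp => ?_) fun e => ?_)
    · rw [j3 p hp, openPos_eq_false_of_gt hμ hp]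
    · rw [e] at hb
      simp at hb
  · intro hns
    rw [Finsupp.notMem_support_iff, t1] at hns
    exact absurd hns one_ne_zero

/-- Induction on the total height of `S`: pairing with the matching opened by `S` gives the
coefficient of `S` plus integer multiples of coefficients of strictly lower sets. -/
theorem klVec_integral {n : ℕ} {μ : YoungDiagram} (hμ : μ ≤ staircase n) (w : ℕ × ℕ → ℚ)
    (hpair : ∀ π, IsNCMatching (2 * n) π → ∃ z : ℤ, pairing (2 * n) π (klVec n w μ) = z)
    (hballot : ∀ p ≤ 2 * n, p ≤ 2 * height (openPos n μ) p) (S : ℕ → Bool) :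
    ∃ z : ℤ, klVec n w μ S = z := by
  classical
  obtain ⟨-, t2⟩ := klVec_triangular w hμ
  suffices h : klVec n w μ S ∈ (Int.castRingHom ℚ).range by
    obtain ⟨z, hz⟩ := h
    exact ⟨z, hz.symm⟩
  induction hd : ∑ p ∈ Finset.range (2 * n + 1), height S p using Nat.strong_induction_on
    generalizing S with
  | _ d ih =>
    by_cases hS : klVec n w μ S = 0
    · rw [hS]
      exact zero_mem _
    obtain ⟨j1, j2, j3⟩ := t2 S hS
    obtain ⟨π, h, hop⟩ := exists_opens S
      (fun p hp => (hballot p hp).trans (Nat.mul_le_mul_left 2 (j1 p))) j2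
    obtain ⟨z, hz⟩ := hpair π h
    rw [pairing_eq_sum, ← Finset.add_sum_erase _ _ (Finsupp.mem_support_iff.2 hS),
      bracket_of_opens h hop, Int.cast_one, mul_one, ← eq_sub_iff_add_eq] at hz
    rw [hz]
    refine sub_mem ⟨z, rfl⟩ (sum_mem fun T hT => ?_)
    rw [Finset.mem_erase, Finsupp.mem_support_iff] at hT
    by_cases hb : bracket (2 * n) π T = 0
    · rw [hb, Int.cast_zero, mul_zero]
      exact zero_mem _
    refine mul_mem (ih (∑ p ∈ Finset.range (2 * n + 1), height T p) ?_ T rfl) ⟨_, rfl⟩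
    have hle : ∀ p ∈ Finset.range (2 * n + 1), height T p ≤ height S p := fun p hp =>
      height_le_of_bracket_ne_zero h hop hb (by simpa [Nat.lt_succ_iff] using hp)
    rw [← hd]
    refine (Finset.sum_le_sum hle).lt_of_ne fun e => hT.1 ?_
    rw [Finset.sum_eq_sum_iff_of_le hle] at e
    obtain ⟨-, -, k3⟩ := t2 T hT.2
    funext p
    by_cases hp : p = 0 ∨ 2 * n < p
    · rw [j3 p hp, k3 p hp]
    · exact eq_of_height_eq (N := 2 * n) (fun q hq => e q (by simp; omega)) (by omega) (by omega)

/-! ### The pairing of `KL` with a matching -/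

/-- By adjunction a box operator turns the form of `π` into a combination of those of `π` and
`joinAt π m`, so vanishing on a class stable under these joins is preserved. -/
theorem pairing_foldl_boxOp_eq_zero {n N : ℕ} {w : ℕ × ℕ → ℚ} {Q : (ℕ → ℕ) → Prop}
    (hQ : ∀ π, Q π → IsNCMatching N π) {l : List (ℕ × ℕ)}
    (hl : ∀ c ∈ l, 1 ≤ content n c ∧ content n c + 1 ≤ N)
    (hjoin : ∀ c ∈ l, ∀ π, Q π → Q (joinAt π (content n c))) {f : ConfigSpace ℚ}
    (hf : ∀ π, Q π → pairing N π f = 0) :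
    ∀ π, Q π → pairing N π (l.foldl (boxOp n w) f) = 0 := by
  induction l generalizing f with
  | nil => exact hf
  | cons c l ih =>
    rw [List.foldl_cons]
    refine ih (fun d hd => hl d (by simp [hd])) (fun d hd => hjoin d (by simp [hd]))
      fun π hπ => ?_
    obtain ⟨h1, h2⟩ := hl c (by simp)
    rw [boxOp, map_add, map_smul, hf π hπ, smul_zero, add_zero]
    by_cases hm : π (content n c) = content n c + 1
    · rw [pairing_swapOp_of_arc (hQ π hπ) h1 h2 hm, hf π hπ, neg_zero]
    · rw [pairing_swapOp (hQ π hπ) h1 h2 hm, hf π hπ, hf _ (hjoin c (by simp) π hπ), add_zero]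

theorem pairing_klVec_of_not_opens {n : ℕ} {μ : YoungDiagram} (hμ : μ ≤ staircase n) {π : ℕ → ℕ}
    (h : IsNCMatching (2 * n) π) (hop : ¬ Opens (2 * n) π (openPos n μ)) :
    pairing (2 * n) π (klVec n (boxWeight μ) μ) = 0 := by
  induction hd : μ.cells.card using Nat.strong_induction_on generalizing μ π with
  | _ d ih =>
    by_cases hbot : μ = ⊥
    · subst hbot
      rw [klVec, rowReading_bot, List.foldl_nil, pairing_single,
        (bracket_initial h fun p p1 _ => by rw [openPos_bot]; omega).2 hop]
      simp
    · obtain ⟨r, r', c, c', hb⟩ := exists_isBlock hbot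
      have l1 := hb.le_row
      have l2 := hb.le_col
      have l3 := hb.row_bound hμ
      have l4 := mem_of_le_staircase hμ hb.mem
      have hν : eraseQuadrant μ r c ≤ staircase n := (eraseQuadrant_le μ r c).trans hμ
      -- An arc in the window contains an arc between neighbours `m`, `m + 1`, where `KL` is
      -- symmetric and the bracket antisymmetric.
      by_cases hin : ∃ p, n + c < p + r' + 1 ∧ p < π p ∧ π p + r ≤ n + c' + 1
      · obtain ⟨p, p1, p2, p3⟩ := hin
        obtain ⟨m, m1, m2, m3⟩ := h.exists_short_arc p2
        have p4 := h.mem_of_lt p2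
        have hinv := swapOp_klVec hμ (m := m) (by omega) (by omega) (fun e => by
          by_cases hm : m + r' ≤ n + c'
          · rw [hb.openPos_false (by omega) hm] at e
            simp at e
          · rw [hb.openPos_true hμ (p := m + 1) (by omega) (by omega)] at e
            simp at e)
        have := pairing_swapOp_of_arc h (by omega) (by omega) m3 (klVec n (boxWeight μ) μ)
        rw [hinv] at this
        linarith
      · obtain ⟨s, hs⟩ : ∃ s, s + r' + 1 = n + c := ⟨n + c - (r' + 1), by omega⟩
        obtain ⟨a, ha⟩ : ∃ a, a + r = r' + 1 := ⟨r' + 1 - r, by omega⟩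
        obtain ⟨b, hb'⟩ : ∃ b, b + c = c' + 1 := ⟨c' + 1 - c, by omega⟩
        have hin' : ∀ p, s < p → p ≤ s + a + b → ¬ (s < π p ∧ π p ≤ s + a + b) := by
          intro p p1 p2 p3
          apply hin
          have e1 := h.invol p
          have e2 := (h.ne_iff p).2 ⟨by omega, by omega⟩
          rcases lt_or_gt_of_ne e2 with hlt | hgt
          · exact ⟨π p, by omega, by omega, by omega⟩
          · exact ⟨p, by omega, by omega, by omega⟩
        rw [hb.klVec_eq hμ]
        -- The class consists of the matchings that keep all arcs of `π` with both ends outside the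
        -- window; joins inside the window preserve it.
        refine pairing_foldl_boxOp_eq_zero (N := 2 * n)
          (Q := fun π' => IsNCMatching (2 * n) π' ∧ ∀ p, ¬ (s < p ∧ p ≤ s + a + b) →
            ¬ (s < π p ∧ π p ≤ s + a + b) → π' p = π p) (fun _ hQ => hQ.1) ?_ ?_ ?_ π
          ⟨h, fun _ _ _ => rfl⟩
        · rintro ⟨i, j⟩ hd
          rw [mem_rectBoxes] at hd
          simp only [content]
          omega
        · rintro ⟨i, j⟩ hd π' ⟨hπ', hQ⟩
          rw [mem_rectBoxes] at hd
          have hm1 : s < content n (i, j) := by simp only [content]; omega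
          have hm2 : content n (i, j) + 1 ≤ s + a + b := by simp only [content]; omega
          generalize content n (i, j) = m at *
          refine ⟨hπ'.joinAt (by omega) (by omega), fun p p1 p2 => ?_⟩
          have e1 := hQ p p1 p2
          have e2 := hπ'.invol m
          have e3 := hπ'.invol (m + 1)
          unfold joinAt
          split_ifs with c1 c2 c3 c4
          · omega
          · omega
          · have e4 : π' p = m := by rw [c3, e2]
            omega
          · have e4 : π' p = m + 1 := by rw [c4, e3]
            omega
          · exact e1
        · rintro π' ⟨hπ', hQ⟩
          refine ih _ (hd ▸ hb.card_lt) hν hπ' (fun hop' => hop fun p p1 pN => ?_) rfl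
          have hbnd : s + a + b + a ≤ 2 * n := by
            rcases Nat.eq_zero_or_pos r with h0 | h0
            · omega
            · have := mem_of_le_staircase hμ (hb.mem_above h0)
              omega
          have hshape := h.eq_shape hπ' (s := s) (a := a) (b := b) (by omega) (by omega) (by omega)
            (fun q q1 q2 => (hop' q (by omega) (by omega)).1
              (hb.openPos_erase_true hμ (by omega) (by omega)))
            (fun q q1 q2 => by
              have e1 := hb.openPos_erase_false (n := n) (p := q) (by omega) (by omega)
              have e2 := hop' q (by omega) (by omega)
              rw [e1] at e2
              have e3 := (hπ'.ne_iff q).2 ⟨by omega, by omega⟩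
              simp at e2
              omega) hin' hQ p
          obtain ⟨s1, s2, s3⟩ := hshape
          by_cases hw : s < p ∧ p ≤ s + a + b
          · by_cases hsb : p ≤ s + b
            · have e := s2 hw.1 hsb
              rw [hb.openPos_false (by omega) (by omega)]
              simp
              omega
            · have e := s3 (by omega) hw.2
              rw [hb.openPos_true hμ (by omega) (by omega)]
              simpa using e
          · rw [s1 hw, ← hop' p p1 pN, hb.openPos_erase_eq (by omega)]

open MvPolynomial

/-! ### Realization by polynomials -/

section Realization

variable {R : Type*} [CommRing R]

/-- The squarefree monomial with set of positions `S`. -/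
noncomputable def configMonomial (R : Type*) [CommRing R] (N : ℕ) (S : ℕ → Bool) :
    MvPolynomial (Fin N) R := ∏ i : Fin N, if S (i + 1) = true then X i else 1

/-- The polynomial attached to a formal combination of sets of positions. -/
noncomputable def toPoly (N : ℕ) : ConfigSpace R →ₗ[R] MvPolynomial (Fin N) R :=
  Finsupp.linearCombination R (configMonomial R N)

theorem toPoly_single (N : ℕ) (S : ℕ → Bool) (r : R) :
    toPoly N (Finsupp.single S r) = r • configMonomial R N S := by
  simp [toPoly]

theorem simpleSwap_val {N m : ℕ} (h1 : 1 ≤ m) (hN : m + 1 ≤ N) (i : Fin N) :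
    ((simpleSwap N m i : Fin N) : ℕ) + 1 = Equiv.swap m (m + 1) ((i : ℕ) + 1) := by
  rw [simpleSwap, dif_pos ⟨h1, by omega⟩, Equiv.swap_apply_def, Equiv.swap_apply_def]
  simp only [Fin.ext_iff]
  split_ifs <;> grind

theorem rename_configMonomial {N m : ℕ} (h1 : 1 ≤ m) (hN : m + 1 ≤ N) (S : ℕ → Bool) :
    rename (simpleSwap N m) (configMonomial R N S) = configMonomial R N (swapAt m S) := by
  rw [configMonomial, configMonomial, map_prod]
  refine Fintype.prod_equiv (simpleSwap N m) _ _ fun i => ?_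
  rw [swapAt, simpleSwap_val h1 hN, Equiv.swap_apply_self]
  split_ifs
  · rw [rename_X]
  · rw [map_one]

theorem rename_toPoly {N m : ℕ} (h1 : 1 ≤ m) (hN : m + 1 ≤ N) (f : ConfigSpace R) :
    rename (simpleSwap N m) (toPoly N f) = toPoly N (swapOp m f) := by
  induction f using Finsupp.induction_linear with
  | zero => simp
  | add f g hf hg => simp only [map_add, hf, hg]
  | single S r =>
    rw [swapOp_single, toPoly_single, toPoly_single, map_smul, rename_configMonomial h1 hN]

end Realization

theorem map_toPoly (N : ℕ) (f : ConfigSpace ℤ) :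
    MvPolynomial.map (Int.castRingHom ℚ) (toPoly N f) =
      toPoly N (Finsupp.mapRange (Int.cast : ℤ → ℚ) Int.cast_zero f) := by
  induction f using Finsupp.induction_linear with
  | zero => simp
  | add f g hf hg =>
    rw [Finsupp.mapRange_add (by simp), map_add, map_add, map_add, hf, hg]
  | single S r =>
    rw [Finsupp.mapRange_single, toPoly_single, toPoly_single, smul_eq_C_mul, smul_eq_C_mul,
      map_mul, map_C]
    congr 1
    rw [configMonomial, configMonomial, map_prod]
    refine Finset.prod_congr rfl fun i _ => ?_
    split_ifs <;> simp

theorem pairing_mapRange (N : ℕ) (π : ℕ → ℕ) (f : ConfigSpace ℤ) :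
    pairing N π (Finsupp.mapRange (Int.cast : ℤ → ℚ) Int.cast_zero f) =
      ((pairing N π f : ℤ) : ℚ) := by
  induction f using Finsupp.induction_linear with
  | zero => simp
  | add f g hf hg =>
    rw [Finsupp.mapRange_add (by simp), map_add, map_add, hf, hg, Int.cast_add]
  | single S r =>
    rw [Finsupp.mapRange_single, pairing_single, pairing_single]
    simp

theorem KLx_eq_toPoly {n : ℕ} {μ : YoungDiagram} (hμ : μ ≤ staircase n) :
    KLx n μ = toPoly (2 * n) (klVec n (boxWeight μ) μ) := by
  have h0 : KLx0 n = toPoly (2 * n) (Finsupp.single (openPos n ⊥) 1) := by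
    rw [toPoly_single, one_smul, KLx0, configMonomial]
    refine Finset.prod_congr rfl fun i _ => ?_
    congr 1
    rw [openPos_bot, eq_iff_iff]
    omega
  have hfold : ∀ (l : List (ℕ × ℕ)) (f : ConfigSpace ℚ), (∀ c ∈ l, c ∈ μ) →
      l.foldl (fun f c => rename (simpleSwap (2 * n) (content n c)) f +
        C ((1 + (depth μ c : ℚ))⁻¹) * f) (toPoly (2 * n) f) =
      toPoly (2 * n) (l.foldl (boxOp n (boxWeight μ)) f) := by
    intro l
    induction l with
    | nil => exact fun _ _ => rfl
    | cons c l ih =>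
      intro f hl
      obtain ⟨h1, h2⟩ := one_le_content hμ (hl c (by simp))
      rw [List.foldl_cons, List.foldl_cons, ← ih _ fun d hd => hl d (by simp [hd]), boxOp, map_add,
        map_smul, rename_toPoly h1 h2, smul_eq_C_mul, boxWeight]
  rw [KLx, h0, hfold _ _ fun c hc => (mem_rowReading μ c).1 hc, klVec]

/-! ### The form and the action of the symmetric group -/

/-- Reindex the sum over permutations by left multiplication by `e`. -/
theorem signForm_rename {N : ℕ} (e : Equiv.Perm (Fin N)) (p : MvPolynomial (Fin N) ℤ) :
    signForm N (rename e p) = ((Equiv.Perm.sign e : ℤˣ) : ℤ) * signForm N p := by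
  rw [signForm_apply, signForm_apply, ← Equiv.sum_comp (Equiv.mulLeft e), Finset.mul_sum]
  refine Finset.sum_congr rfl fun τ _ => ?_
  rw [Equiv.coe_mulLeft, Equiv.Perm.coe_mul, Finsupp.mapDomain_comp,
    coeff_rename_mapDomain _ e.injective, Equiv.Perm.sign_mul]
  push_cast
  ring

theorem signFormCoinv_act {N : ℕ} (e : Equiv.Perm (Fin N)) (g : Coinv N) :
    signFormCoinv N (act e g) = ((Equiv.Perm.sign e : ℤˣ) : ℤ) * signFormCoinv N g := by
  obtain ⟨p, rfl⟩ := Ideal.Quotient.mk_surjective g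
  rw [act_mk]
  exact signForm_rename e p

/-- The form depends only on the product, and its linear form changes by the sign under
permutations. -/
theorem form_act_simpleSwap {N m : ℕ} (h1 : 1 ≤ m) (hN : m + 1 ≤ N) (f g : Coinv N) :
    form N f (act (simpleSwap N m) g) = - form N (act (simpleSwap N m) f) g := by
  have hs : simpleSwap N m * simpleSwap N m = 1 := by
    rw [simpleSwap, dif_pos ⟨h1, by omega⟩, Equiv.swap_mul_self]
  have hsign : Equiv.Perm.sign (simpleSwap N m) = -1 := by
    rw [simpleSwap, dif_pos ⟨h1, by omega⟩, Equiv.Perm.sign_swap]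
    simp only [ne_eq, Fin.ext_iff]
    omega
  have hone : ∀ h : Coinv N, act (1 : Equiv.Perm (Fin N)) h = h := by
    intro h
    obtain ⟨p, rfl⟩ := Ideal.Quotient.mk_surjective h
    rw [act_mk, Equiv.Perm.coe_one, rename_id_apply]
  have e : f * act (simpleSwap N m) g =
      act (simpleSwap N m) (act (simpleSwap N m) f * g) := by
    rw [map_mul, act_act, hs, hone]
  change signFormCoinv N (f * act (simpleSwap N m) g) =
    - signFormCoinv N (act (simpleSwap N m) f * g)
  rw [e, signFormCoinv_act, hsign]
  simp

/-! ### The family `LK` as matchings -/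

theorem configMonomial_eq_monomial (N : ℕ) (S : ℕ → Bool) :
    configMonomial ℤ N S = monomial (Finsupp.equivFunOnFinite.symm
      fun i : Fin N => if S (i + 1) = true then 1 else 0) 1 := by
  rw [monomial_eq, C_1, one_mul, Finsupp.prod_fintype _ _ (by simp), configMonomial]
  refine Finset.prod_congr rfl fun i _ => ?_
  simp only [Finsupp.equivFunOnFinite_symm_apply_apply]
  split_ifs <;> simp

theorem prod_Icc_two_mul {M : Type*} [CommMonoid M] (f : ℕ → M) (n : ℕ) :
    ∏ j ∈ Finset.Icc 1 (2 * n), f j = ∏ k ∈ Finset.range n, (f (2 * k + 1) * f (2 * k + 2)) := by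
  induction n with
  | zero => simp
  | succ n ih =>
    rw [Finset.prod_range_succ, ← ih, show 2 * (n + 1) = 2 * n + 1 + 1 by ring,
      Finset.prod_Icc_succ_top (by omega), Finset.prod_Icc_succ_top (by omega), mul_assoc]

theorem bracket_pairMatching (n : ℕ) (S : ℕ → Bool) : bracket (2 * n) (pairMatching n) S =
    ∏ k : Fin n, if S (2 * k + 1) = S (2 * k + 2) then 0
      else if S (2 * k + 1) = true then 1 else -1 := by
  rw [bracket, prod_Icc_two_mul, ← Fin.prod_univ_eq_prod_range
    (fun k => arcWeight (pairMatching n) S (2 * k + 1) * arcWeight (pairMatching n) S (2 * k + 2))]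
  refine Finset.prod_congr rfl fun k _ => ?_
  have hk := k.2
  have e1 : pairMatching n (2 * k + 1) = 2 * k + 2 := by
    unfold pairMatching
    split_ifs <;> omega
  have e2 : pairMatching n (2 * k + 2) = 2 * k + 1 := by
    unfold pairMatching
    split_ifs <;> omega
  simp only [arcWeight, e1, e2]
  cases S (2 * k + 1) <;> cases S (2 * k + 2) <;> simp

/-- The permutation that reverses the pairs of positions, and exchanges the elements of a pair
where `t` is false. -/
def pairPerm (n : ℕ) (t : Fin n → Bool) : Equiv.Perm (Fin n × Fin 2) :=
  (Equiv.prodCongrRight fun k => if t k = true then (1 : Equiv.Perm (Fin 2)) else Equiv.swap 0 1) *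
    Equiv.prodCongrLeft fun _ => Fin.revPerm

/-- The reversal acts alike on the two columns, so its sign is a square and only the exchanges
inside pairs count. -/
theorem sign_pairPerm (n : ℕ) (t : Fin n → Bool) :
    ((Equiv.Perm.sign (pairPerm n t) : ℤˣ) : ℤ) = ∏ k, if t k = true then 1 else -1 := by
  rw [pairPerm, Equiv.Perm.sign_mul, Equiv.Perm.sign_prodCongrRight,
    Equiv.Perm.sign_prodCongrLeft, Fin.prod_univ_two, Int.units_mul_self, mul_one, Units.coe_prod]
  refine Finset.prod_congr rfl fun k _ => ?_
  split_ifs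
  · simp
  · rw [Equiv.Perm.sign_swap (by decide)]
    rfl

/-- The positions `0, …, 2n - 1` as pairs. -/
def pairEquiv (n : ℕ) : Fin n × Fin 2 ≃ Fin (2 * n) :=
  finProdFinEquiv.trans (finCongr (mul_comm n 2))

theorem pairEquiv_val (n : ℕ) (x : Fin n × Fin 2) :
    (pairEquiv n x : ℕ) = x.2 + 2 * x.1 := rfl

/-- The pair `k` carries exponents in `{2k, 2k + 1}`, both values occurring iff `S` contains exactly
one of the two positions. The pairs increase while `delta` decreases, hence the reversal in
`pairPerm`; a pair is in the order of `delta` when `S` contains its first position. -/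
theorem signForm_configMonomial_mul (n : ℕ) (S : ℕ → Bool) :
    signForm (2 * n) (configMonomial ℤ (2 * n) S *
      monomial (Finsupp.equivFunOnFinite.symm fun p : Fin (2 * n) => 2 * ((p : ℕ) / 2)) 1) =
      bracket (2 * n) (pairMatching n) S := by
  rw [configMonomial_eq_monomial, monomial_mul, one_mul, bracket_pairMatching]
  set v : Fin (2 * n) →₀ ℕ := (Finsupp.equivFunOnFinite.symm
      fun i : Fin (2 * n) => if S (i + 1) = true then 1 else 0) +
      Finsupp.equivFunOnFinite.symm fun p : Fin (2 * n) => 2 * ((p : ℕ) / 2) with hv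
  have hvi : ∀ i, v i = (if S (i + 1) = true then 1 else 0) + 2 * ((i : ℕ) / 2) := fun i => rfl
  have hvp : ∀ (k : Fin n) (ε : Fin 2), v (pairEquiv n (k, ε)) =
      (if S (2 * k + 1 + ε) = true then 1 else 0) + 2 * k := fun k ε => by
    have h1 : ((pairEquiv n (k, ε) : Fin (2 * n)) : ℕ) + 1 = 2 * k + 1 + ε := by
      rw [pairEquiv_val]
      ring
    have h2 : ((pairEquiv n (k, ε) : Fin (2 * n)) : ℕ) / 2 = k := by
      have := ε.2
      rw [pairEquiv_val]
      simp only
      omega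
    rw [hvi, h1, h2]
  by_cases hS : ∃ k : Fin n, S (2 * k + 1) = S (2 * k + 2)
  · obtain ⟨k, hk⟩ := hS
    rw [Finset.prod_eq_zero (i := k) (Finset.mem_univ _) (by simp [hk])]
    refine signForm_monomial_of_not_perm _ _ fun σ hσ => ?_
    have hvσ : ∀ i, v i = delta (2 * n) (σ.symm i) := fun i => by
      rw [← hσ]
      conv_lhs => rw [← σ.apply_symm_apply i]
      exact Finsupp.mapDomain_apply σ.injective _ _
    have e : v (pairEquiv n (k, 0)) = v (pairEquiv n (k, 1)) := by
      rw [hvp, hvp]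
      simp [hk]
    rw [hvσ, hvσ] at e
    simp only [delta, Finsupp.equivFunOnFinite_symm_apply_apply] at e
    have e' : σ.symm (pairEquiv n (k, 0)) = σ.symm (pairEquiv n (k, 1)) := by
      ext
      omega
    simp at e'
  · push Not at hS
    have e : (delta (2 * n)).mapDomain
        ((pairEquiv n).permCongr (pairPerm n fun k => S (2 * k + 1))) = v := by
      ext i
      obtain ⟨x, rfl⟩ := ((pairEquiv n).permCongr
        (pairPerm n fun k => S (2 * k + 1))).surjective i
      obtain ⟨⟨k, ε⟩, rfl⟩ := (pairEquiv n).surjective x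
      have hpp : pairPerm n (fun k => S (2 * k + 1)) (k, ε) = (k.rev,
        (if S (2 * k.rev + 1) = true then (1 : Equiv.Perm (Fin 2)) else Equiv.swap 0 1) ε) := rfl
      rw [Finsupp.mapDomain_apply (Equiv.injective _), Equiv.permCongr_apply,
        Equiv.symm_apply_apply, hpp, hvp]
      have hk := hS k.rev
      have hq : (k.rev : ℕ) + (k + 1) = n := by
        have := k.2
        rw [Fin.val_rev]
        omega
      simp only [delta, Finsupp.equivFunOnFinite_symm_apply_apply, pairEquiv_val]
      generalize k.rev = q at *
      cases h1 : S (2 * q + 1) <;> cases h2 : S (2 * q + 2) <;> fin_cases ε <;>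
        simp [h1, h2] at hk ⊢ <;> omega
    rw [← e, signForm_monomial_perm, Equiv.Perm.sign_permCongr, sign_pairPerm]
    exact Finset.prod_congr rfl fun k _ => by rw [if_neg (hS k)]

theorem form_LKxTop (n : ℕ) (f : ConfigSpace ℤ) :
    form (2 * n) (Ideal.Quotient.mk _ (toPoly (2 * n) f)) (LKxTop n) =
      pairing (2 * n) (pairMatching n) f := by
  rw [LKxTop, form_mk]
  induction f using Finsupp.induction_linear with
  | zero => simp
  | add f g hf hg => rw [map_add, map_add, add_mul, map_add, hf, hg]
  | single S r =>
    rw [toPoly_single, pairing_single, smul_mul_assoc, map_smul, signForm_configMonomial_mul]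
    simp

/-- Downward induction from the staircase. The operator `-(s_i + 1)` has adjoint `s_i - 1`, which by
the three-term relation replaces the matching by its join at `i`. -/
theorem exists_matching_LKx {n : ℕ} {μ : YoungDiagram} (hμ : μ ≤ staircase n) :
    ∃ π, IsNCMatching (2 * n) π ∧ Opens (2 * n) π (openPos n μ) ∧ ∀ f : ConfigSpace ℤ,
      form (2 * n) (Ideal.Quotient.mk _ (toPoly (2 * n) f)) (LKx n μ) = pairing (2 * n) π f := by
  induction hd : (staircase n).cells.card - μ.cells.card using Nat.strong_induction_on
    generalizing μ with
  | _ d ih =>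
    by_cases hne : μ = staircase n
    · subst hne
      refine ⟨pairMatching n, isNCMatching_pairMatching n, fun p p1 pN => ?_, fun f => ?_⟩
      · rw [openPos_staircase n p1 pN]
        unfold pairMatching
        split_ifs <;> omega
      · rw [LKx_staircase, form_LKxTop]
    · obtain ⟨ν, c, hν, hc, he⟩ := exists_add_corner hμ hne
      have hlt : μ.cells.card < ν.cells.card := by
        rw [he]
        exact Finset.card_erase_lt_of_mem (by simpa using hc.1)
      have hle := Finset.card_le_card (YoungDiagram.cells_subset_iff.2 hν)
      obtain ⟨π, h, hop, hform⟩ := ih _ (by omega) hν rfl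
      obtain ⟨o1, o2, o3⟩ := openPos_of_erase hν hc he
      obtain ⟨m1, m2⟩ := one_le_content hν hc.1
      have hμν : openPos n μ = swapAt (content n c) (openPos n ν) := by
        rw [o3, swapAt_swapAt]
      have c1 : openPos n ν (content n c) = false := by rw [o3, swapAt_left, o2]
      have c2 : openPos n ν (content n c + 1) = true := by rw [o3, swapAt_right, o1]
      refine ⟨joinAt π (content n c), h.joinAt m1 m2, ?_, fun f => ?_⟩
      · rw [hμν]
        exact hop.joinAt h m1 m2 c1 c2
      · have hna : π (content n c) ≠ content n c + 1 := fun e => by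
          have := (hop (content n c) m1 (by omega)).2 (by omega)
          rw [c1] at this
          simp at this
        rw [LKx_erase_corner n hν hc he, map_neg, map_add, form_act_simpleSwap m1 m2, act_mk,
          rename_toPoly m1 m2, hform, hform, pairing_swapOp h m1 m2 hna]
        ring

end KLDual

/-! ### The duality -/

theorem mainTheorem9 (n : ℕ) (lam : YoungDiagram) (hlam : lam ≤ KLDual.staircase n) :
    ∃ P : MvPolynomial (Fin (2 * n)) ℤ,
      MvPolynomial.map (Int.castRingHom ℚ) P = KLDual.KLx n lam ∧
      ∀ mu : YoungDiagram, mu ≤ KLDual.staircase n →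
        KLDual.form (2 * n) (Ideal.Quotient.mk (KLDual.symPlus (2 * n)) P) (KLDual.LKx n mu) =
          if lam = mu then 1 else 0 := by
  open KLDual in
  have hpair : ∀ π, IsNCMatching (2 * n) π → ∃ z : ℤ,
      pairing (2 * n) π (klVec n (boxWeight lam) lam) = z := fun π h => by
    by_cases hop : Opens (2 * n) π (openPos n lam)
    · exact ⟨1, by rw [pairing_klVec_of_opens hlam h hop, Int.cast_one]⟩
    · exact ⟨0, by rw [pairing_klVec_of_not_opens hlam h hop, Int.cast_zero]⟩
  -- Needed here only for the ballot property of the boundary of `lam`.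
  obtain ⟨π₀, h₀, hop₀, -⟩ := exists_matching_LKx hlam
  have hint := klVec_integral hlam _ hpair fun p hp => hop₀.le_two_mul_height h₀ hp
  -- The coefficients are integers, so taking numerators loses nothing.
  set f : ConfigSpace ℤ := (klVec n (boxWeight lam) lam).mapRange Rat.num Rat.num_zero with hf
  have hcast : f.mapRange (Int.cast : ℤ → ℚ) Int.cast_zero = klVec n (boxWeight lam) lam := by
    ext S
    obtain ⟨z, hz⟩ := hint S
    rw [hf, Finsupp.mapRange_apply, Finsupp.mapRange_apply, hz, Rat.num_intCast]
  refine ⟨toPoly (2 * n) f, by rw [map_toPoly, hcast, KLx_eq_toPoly hlam], fun mu hmu => ?_⟩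
  obtain ⟨π, h, hop, hform⟩ := exists_matching_LKx hmu
  rw [hform, ← Int.cast_inj (α := ℚ), ← pairing_mapRange, hcast]
  split_ifs with heq
  · subst heq
    rw [pairing_klVec_of_opens hlam h hop, Int.cast_one]
  · rw [pairing_klVec_of_not_opens hlam h, Int.cast_zero]
    intro hop'
    refine heq (eq_of_openPos_eq hlam hmu fun p => ?_)
    by_cases hp : p = 0 ∨ 2 * n < p
    · rw [openPos_eq_false_of_gt hlam hp, openPos_eq_false_of_gt hmu hp]
    · rw [Bool.eq_iff_iff, hop p (by omega) (by omega), hop' p (by omega) (by omega)]
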